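/- **Conventions.** Let $k$ be a field; $\otimes=\otimes_k$; the identity map of a vector space $X$ is also written $X$. For $f:X\otimes Z\to X'\otimes Z'$ let $f^{13}:X\otimes Y\otimes Z\to X'\otimes Y\otimes Z'$ act as $f$ on the first and third legs. For a $k$-algebra $A$ (not necessarily unital) with multiplication $\mu$, expressions such as $(1\otimes a)x$ or $x(b\otimes 1)$ mean multiplication in the indicated tensor factor of $A$. A multiplier on $A$ is a pair $(\lambda,\varrho)$ of linear maps $A\to A$ with $a\lambda(b)=\varrho(a)b$; multipliers form the algebra $\mathbb M(A)$, and for $m=(\lambda,\varrho)$ one writes $mb=\lambda(b)$, $bm=\varrho(b)$. **Regular weak multiplier bialgebras.** A *regular weak multiplier bialgebra* over $k$ is an associative $k$-algebra $A$ that is idempotent ($A$ is spanned by products) and non-degenerate ($ab=0\ \forall b$, or $ba=0\ \forall b$, implies $a=0$), with linear maps $E_1,E_2,T_1,T_2,T_3,T_4:A\otimes A\to A\otimes A$ and $\epsilon:A\to k$ such that, for all $a,b,c,d\in A$, 1. $(a\otimes b)E_1(c\otimes d)=E_2(a\otimes b)(c\otimes d)$; 2. $E_1^2=E_1$; 3.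 $(T_2\otimes A)(A\otimes T_1)=(A\otimes T_1)(T_2\otimes A)$; 4. $(\epsilon\otimes A)T_1=\mu=(A\otimes\epsilon)T_2$; 5. $(\mu\otimes A)T_1^{13}(A\otimes T_1)=T_1(\mu\otimes A)$; 6. the elements $T_1(a\otimes c)(b\otimes 1)$ span the same subspace as the elements $E_1(b\otimes c)$, and the elements $(1\otimes c)T_2(b\otimes a)$ span the same subspace as the elements $E_2(b\otimes c)$; 7. $(E_1\otimes A)(A\otimes T_1)=(A\otimes T_1)(E_1\otimes A)$ and $(E_2\otimes A)(A\otimes T_2)=(A\otimes T_2)E_2^{13}$; 8. $(\epsilon\otimes A)((1\otimes a)E_1(b\otimes c))=(\epsilon\otimes A)(T_1(a\otimes c)(b\otimes 1))$ and $(\epsilon\otimes A)(E_2(a\otimes b)(1\otimes c))=(\epsilon\otimes A)((1\otimes b)T_2(a\otimes c))$; 9. $(1\otimes a)T_1(c\otimes b)=T_3(c\otimes a)(1\otimes b)$ and $T_2(a\otimes c)(b\otimes 1)=(a\otimes 1)T_4(b\otimes c)$. Its comultiplication is *right full* if $A$ is spanned by the elements $(A\otimes\omega)T_1(a\otimes b)$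 with $a,b\in A$ and $\omega:A\to k$ linear. Maps $\overline\sqcap^R,\sqcap^R:A\to\mathbb M(A)$ are defined by $$\overline\sqcap^R(a)b=(A\otimes\epsilon)E_1(b\otimes a),\quad b\overline\sqcap^R(a)=(A\otimes\epsilon)T_1(b\otimes a),\quad \sqcap^R(a)b=(A\otimes\epsilon)T_3(b\otimes a),\quad b\sqcap^R(a)=(A\otimes\epsilon)E_2(b\otimes a).$$ In the right full case the ranges of $\sqcap^R$ and $\overline\sqcap^R$ coincide; this common range is denoted $R$. **Comodules.** A *right $A$-comodule* is a vector space $V$ with linear maps $\lambda,\varrho:V\otimes A\to V\otimes A$ such that $(1\otimes a)\lambda(v\otimes b)=\varrho(v\otimes a)(1\otimes b)$ for all $v\in V$, $a,b\in A$, and $$(\lambda\otimes A)\lambda^{13}(V\otimes E_1)=(\lambda\otimes A)\lambda^{13},\qquad (\lambda\otimes A)\lambda^{13}(V\otimes T_1)=(V\otimes T_1)(\lambda\otimes A).$$ It is *full* if $V$ is spanned by the elements $(V\otimes\omega)\lambda(v\otimes a)$ with $v\in V$, $a\in A$ and $\omega:A\to k$ linear. A morphism $(V,\lambda,\varrho)\to(V',\lambda',\varrho')$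 is a linear map $f:V\to V'$ with $\lambda'(f\otimes A)=(f\otimes A)\lambda$ and $\varrho'(f\otimes A)=(f\otimes A)\varrho$. For right comodules $V,W$, the vector space $V\otimes W$ is a right comodule via $\lambda_V^{13}(V\otimes\lambda_W)$ and $(V\otimes\varrho_W)\varrho_V^{13}$. If the comultiplication is right full, then a full right comodule $V$ is an $R$-bimodule by $$v\,\overline\sqcap^R(a)=(V\otimes\epsilon)\lambda(v\otimes a),\qquad \sqcap^R(a)\,v=(V\otimes\epsilon)\varrho(v\otimes a).$$ For full right comodules $V,W$, let $V\otimes_R W$ be the quotient of $V\otimes W$ by the span of all $vr\otimes w-v\otimes rw$ ($v\in V$, $w\in W$, $r\in R$), with canonical projection $\pi_{V,W}:V\otimes W\to V\otimes_R W$. **Proposition.** Let $A$ be a regular weak multiplier bialgebra over a field $k$ with right full comultiplication, and let $V$ and $W$ be full right $A$-comodules. Then there is a unique right $A$-comodule structure on $V\otimes_R W$ such that $\pi_{V,W}:V\otimes W\to V\otimes_R W$ is a morphism of comodules from the above comodule $V\otimes W$. This comodule $V\otimes_R W$ is again full. -/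

import Mathlib

open scoped TensorProduct

namespace WeakMultiplier

section Legs

variable {k : Type*} [Field k]
variable {X X' Y Y' Z Z' : Type*} [AddCommGroup X] [AddCommGroup X'] [AddCommGroup Y]
  [AddCommGroup Y'] [AddCommGroup Z] [AddCommGroup Z'] [Module k X] [Module k X'] [Module k Y]
  [Module k Y'] [Module k Z] [Module k Z']

/-- `f ⊗ Z`, the map `f` acting on the first two legs. -/
def leg12 (Z : Type*) [AddCommGroup Z] [Module k Z] (f : X ⊗[k] Y →ₗ[k] X' ⊗[k] Y') :
    X ⊗[k] Y ⊗[k] Z →ₗ[k] X' ⊗[k] Y' ⊗[k] Z :=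
  f.rTensor Z

/-- `X ⊗ f`, the map `f` acting on the last two legs. -/
def leg23 (X : Type*) [AddCommGroup X] [Module k X] (f : Y ⊗[k] Z →ₗ[k] Y' ⊗[k] Z') :
    X ⊗[k] Y ⊗[k] Z →ₗ[k] X ⊗[k] Y' ⊗[k] Z' :=
  (TensorProduct.assoc k X Y' Z').symm.toLinearMap ∘ₗ f.lTensor X ∘ₗ
    (TensorProduct.assoc k X Y Z).toLinearMap

/-- `f¹³`, the map `f` acting on the first and the third leg. -/
def leg13 (Y : Type*) [AddCommGroup Y] [Module k Y] (f : X ⊗[k] Z →ₗ[k] X' ⊗[k] Z') :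
    X ⊗[k] Y ⊗[k] Z →ₗ[k] X' ⊗[k] Y ⊗[k] Z' :=
  (TensorProduct.rightComm k X' Z' Y).toLinearMap ∘ₗ f.rTensor Y ∘ₗ
    (TensorProduct.rightComm k X Y Z).toLinearMap

/-- `ω ⊗ X : Y ⊗ X → X` for a functional `ω` on `Y`. -/
def evalFst (X : Type*) [AddCommGroup X] [Module k X] (ω : Y →ₗ[k] k) : Y ⊗[k] X →ₗ[k] X :=
  (TensorProduct.lid k X).toLinearMap ∘ₗ ω.rTensor X

/-- `X ⊗ ω : X ⊗ Y → X` for a functional `ω` on `Y`. -/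
def evalSnd (X : Type*) [AddCommGroup X] [Module k X] (ω : Y →ₗ[k] k) : X ⊗[k] Y →ₗ[k] X :=
  (TensorProduct.rid k X).toLinearMap ∘ₗ ω.lTensor X

end Legs

section TensorAux

variable {k A : Type*} [Field k] [NonUnitalRing A] [Module k A]
variable {V W : Type*} [AddCommGroup V] [Module k V] [AddCommGroup W] [Module k W]

/-- `((V ⊗ W) ⊗ A) ⊗ A ≅ V ⊗ ((W ⊗ A) ⊗ A)`. -/
def isoW (k A V W : Type*) [Field k] [NonUnitalRing A] [Module k A]
    [AddCommGroup V] [Module k V] [AddCommGroup W] [Module k W] :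
    V ⊗[k] W ⊗[k] A ⊗[k] A ≃ₗ[k] V ⊗[k] (W ⊗[k] A ⊗[k] A) :=
  (TensorProduct.congr (TensorProduct.assoc k V W A) (LinearEquiv.refl k A)).trans
    (TensorProduct.assoc k V (W ⊗[k] A) A)

/-- `((V ⊗ W) ⊗ A) ⊗ A ≅ ((V ⊗ A) ⊗ A) ⊗ W`. -/
def isoV (k A V W : Type*) [Field k] [NonUnitalRing A] [Module k A]
    [AddCommGroup V] [Module k V] [AddCommGroup W] [Module k W] :
    V ⊗[k] W ⊗[k] A ⊗[k] A ≃ₗ[k] V ⊗[k] A ⊗[k] A ⊗[k] W :=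
  (TensorProduct.congr (TensorProduct.rightComm k V W A) (LinearEquiv.refl k A)).trans
    (TensorProduct.rightComm k (V ⊗[k] A) W A)

variable (f g : V ⊗[k] A →ₗ[k] V ⊗[k] A) (h : W ⊗[k] A →ₗ[k] W ⊗[k] A)
  (T : A ⊗[k] A →ₗ[k] A ⊗[k] A)

lemma isoW_12 : (isoW k A V W).toLinearMap ∘ₗ leg12 A (leg23 V h) =
    (leg12 A h).lTensor V ∘ₗ (isoW k A V W).toLinearMap := by
  ext v w a b
  simp only [isoW, leg12, leg23, LinearMap.comp_apply, TensorProduct.AlgebraTensorModule.curry_apply,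
    TensorProduct.curry_apply, LinearMap.coe_restrictScalars, LinearEquiv.coe_coe,
    LinearMap.rTensor_tmul, LinearMap.lTensor_tmul, TensorProduct.assoc_tmul,
    LinearEquiv.trans_apply, TensorProduct.congr_tmul, LinearEquiv.refl_apply, LinearEquiv.apply_symm_apply]

lemma isoW_13 : (isoW k A V W).toLinearMap ∘ₗ leg13 A (leg23 V h) =
    (leg13 A h).lTensor V ∘ₗ (isoW k A V W).toLinearMap := by
  ext v w a b
  simp only [isoW, leg13, leg23, LinearMap.comp_apply, TensorProduct.AlgebraTensorModule.curry_apply,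
    TensorProduct.curry_apply, LinearMap.coe_restrictScalars, LinearEquiv.coe_coe,
    LinearMap.rTensor_tmul, LinearMap.lTensor_tmul, TensorProduct.assoc_tmul, TensorProduct.rightComm_tmul,
    LinearEquiv.trans_apply, TensorProduct.congr_tmul, LinearEquiv.refl_apply]
  induction h (w ⊗ₜ b) with
  | zero => simp
  | add y z hy hz => simp only [TensorProduct.add_tmul, TensorProduct.tmul_add, map_add, hy, hz]
  | tmul x c => simp

lemma isoW_23 : (isoW k A V W).toLinearMap ∘ₗ leg23 (V ⊗[k] W) T =
    (leg23 W T).lTensor V ∘ₗ (isoW k A V W).toLinearMap := by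
  ext v w a b
  simp only [isoW, leg23, LinearMap.comp_apply, TensorProduct.AlgebraTensorModule.curry_apply,
    TensorProduct.curry_apply, LinearMap.coe_restrictScalars, LinearEquiv.coe_coe,
    LinearMap.lTensor_tmul, TensorProduct.assoc_tmul,
    LinearEquiv.trans_apply, TensorProduct.congr_tmul, LinearEquiv.refl_apply]
  induction T (a ⊗ₜ b) with
  | zero => simp
  | add y z hy hz => simp only [TensorProduct.tmul_add, map_add, hy, hz]
  | tmul x c => simp

lemma isoV_12 : (isoV k A V W).toLinearMap ∘ₗ leg12 A (leg13 W f) =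
    (leg12 A f).rTensor W ∘ₗ (isoV k A V W).toLinearMap := by
  ext v w a b
  simp only [isoV, leg12, leg13, LinearMap.comp_apply, TensorProduct.AlgebraTensorModule.curry_apply,
    TensorProduct.curry_apply, LinearMap.coe_restrictScalars, LinearEquiv.coe_coe,
    LinearMap.rTensor_tmul, TensorProduct.rightComm_tmul,
    LinearEquiv.trans_apply, TensorProduct.congr_tmul, LinearEquiv.refl_apply]
  induction f (v ⊗ₜ a) with
  | zero => simp
  | add y z hy hz => simp only [TensorProduct.add_tmul, map_add, hy, hz]
  | tmul x c => simp

lemma isoV_13 : (isoV k A V W).toLinearMap ∘ₗ leg13 A (leg13 W f) =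
    (leg13 A f).rTensor W ∘ₗ (isoV k A V W).toLinearMap := by
  ext v w a b
  simp only [isoV, leg13, LinearMap.comp_apply, TensorProduct.AlgebraTensorModule.curry_apply,
    TensorProduct.curry_apply, LinearMap.coe_restrictScalars, LinearEquiv.coe_coe,
    LinearMap.rTensor_tmul, TensorProduct.rightComm_tmul,
    LinearEquiv.trans_apply, TensorProduct.congr_tmul, LinearEquiv.refl_apply]
  induction f (v ⊗ₜ b) with
  | zero => simp
  | add y z hy hz => simp only [TensorProduct.add_tmul, map_add, hy, hz]
  | tmul x c => simp

lemma isoV_23 : (isoV k A V W).toLinearMap ∘ₗ leg23 (V ⊗[k] W) T =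
    (leg23 V T).rTensor W ∘ₗ (isoV k A V W).toLinearMap := by
  ext v w a b
  simp only [isoV, leg23, LinearMap.comp_apply, TensorProduct.AlgebraTensorModule.curry_apply,
    TensorProduct.curry_apply, LinearMap.coe_restrictScalars, LinearEquiv.coe_coe,
    LinearMap.rTensor_tmul, LinearMap.lTensor_tmul, TensorProduct.assoc_tmul, TensorProduct.rightComm_tmul,
    LinearEquiv.trans_apply, TensorProduct.congr_tmul, LinearEquiv.refl_apply]
  induction T (a ⊗ₜ b) with
  | zero => simp
  | add y z hy hz => simp only [TensorProduct.add_tmul, TensorProduct.tmul_add, map_add, hy, hz]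
  | tmul x c => simp

lemma four_comm : leg12 A (leg23 V h) ∘ₗ leg13 A (leg13 W f) =
    leg13 A (leg13 W f) ∘ₗ leg12 A (leg23 V h) := by
  have key : ∀ (y : V ⊗[k] A) (w : W) (a : A),
      leg12 A (leg23 V h) (TensorProduct.rightComm k (V ⊗[k] W) A A
        (TensorProduct.rightComm k V A W (y ⊗ₜ w) ⊗ₜ a)) =
      TensorProduct.rightComm k (V ⊗[k] W) A A ((TensorProduct.assoc k (V ⊗[k] W) A A).symm
        (TensorProduct.tensorTensorTensorComm k V A W A (y ⊗ₜ h (w ⊗ₜ a)))) := by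
    intro y w a
    induction y with
    | zero => simp
    | add y z hy hz => simp only [TensorProduct.add_tmul, map_add, hy, hz]
    | tmul v b =>
      simp only [leg12, leg23, LinearMap.comp_apply, LinearEquiv.coe_coe, LinearMap.rTensor_tmul,
        LinearMap.lTensor_tmul, TensorProduct.assoc_tmul, TensorProduct.rightComm_tmul]
      induction h (w ⊗ₜ a) with
      | zero => simp
      | add y z hy hz => simp only [TensorProduct.add_tmul, TensorProduct.tmul_add, map_add, hy, hz]
      | tmul x c => simp
  have key' : ∀ (z : W ⊗[k] A) (v : V) (b : A),
      leg13 A (leg13 W f) ((TensorProduct.assoc k V W A).symm (v ⊗ₜ z) ⊗ₜ b) =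
      TensorProduct.rightComm k (V ⊗[k] W) A A ((TensorProduct.assoc k (V ⊗[k] W) A A).symm
        (TensorProduct.tensorTensorTensorComm k V A W A (f (v ⊗ₜ b) ⊗ₜ z))) := by
    intro z v b
    induction z with
    | zero => simp
    | add y z hy hz => simp only [TensorProduct.add_tmul, TensorProduct.tmul_add, map_add, hy, hz]
    | tmul w a =>
      simp only [leg13, LinearMap.comp_apply, LinearEquiv.coe_coe, LinearMap.rTensor_tmul,
        TensorProduct.assoc_symm_tmul, TensorProduct.rightComm_tmul]
      induction f (v ⊗ₜ b) with
      | zero => simp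
      | add y z hy hz => simp only [TensorProduct.add_tmul, map_add, hy, hz]
      | tmul x c => simp
  ext v w a b
  have e1 : leg13 A (leg13 W f) (v ⊗ₜ w ⊗ₜ a ⊗ₜ b) = TensorProduct.rightComm k (V ⊗[k] W) A A
        (TensorProduct.rightComm k V A W (f (v ⊗ₜ b) ⊗ₜ w) ⊗ₜ a) := by simp [leg13]
  have e2 : leg12 A (leg23 V h) (v ⊗ₜ w ⊗ₜ a ⊗ₜ b) =
      (TensorProduct.assoc k V W A).symm (v ⊗ₜ h (w ⊗ₜ a)) ⊗ₜ b := by simp [leg12, leg23]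
  simp only [TensorProduct.AlgebraTensorModule.curry_apply, TensorProduct.curry_apply, LinearMap.coe_restrictScalars,
    LinearMap.comp_apply, e1, e2, key, key']

lemma leg12_comp {X : Type*} [AddCommGroup X] [Module k X]
    (p q : X ⊗[k] A →ₗ[k] X ⊗[k] A) : leg12 A (p ∘ₗ q) = leg12 A p ∘ₗ leg12 A q :=
  LinearMap.rTensor_comp _ _ _

lemma leg13_comp {X : Type*} [AddCommGroup X] [Module k X]
    (p q : X ⊗[k] A →ₗ[k] X ⊗[k] A) : leg13 A (p ∘ₗ q) = leg13 A p ∘ₗ leg13 A q := by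
  apply LinearMap.ext; intro x
  have e : ∀ y, TensorProduct.rightComm k X A A (TensorProduct.rightComm k X A A y) = y :=
    fun y => (TensorProduct.rightComm k X A A).symm_apply_apply y
  simp only [leg13, LinearMap.rTensor_comp, LinearMap.comp_apply, LinearEquiv.coe_coe, e]

lemma tensor_mul (f : V ⊗[k] A →ₗ[k] V ⊗[k] A) (h : W ⊗[k] A →ₗ[k] W ⊗[k] A)
    (x : V ⊗[k] W ⊗[k] A ⊗[k] A) :
    leg12 A (leg13 W f ∘ₗ leg23 V h) (leg13 A (leg13 W f ∘ₗ leg23 V h) x) =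
    leg12 A (leg13 W f) (leg13 A (leg13 W f)
      (leg12 A (leg23 V h) (leg13 A (leg23 V h) x))) := by
  have := LinearMap.congr_fun (four_comm f h)
  simp only [LinearMap.comp_apply] at this
  rw [leg12_comp, leg13_comp]
  simp only [LinearMap.comp_apply, this]

lemma norm_W (h : W ⊗[k] A →ₗ[k] W ⊗[k] A) (E : A ⊗[k] A →ₗ[k] A ⊗[k] A)
    (hn : leg12 A h ∘ₗ leg13 A h ∘ₗ leg23 W E = leg12 A h ∘ₗ leg13 A h)
    (x : V ⊗[k] W ⊗[k] A ⊗[k] A) :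
    leg12 A (leg23 V h) (leg13 A (leg23 V h) (leg23 (V ⊗[k] W) E x)) =
    leg12 A (leg23 V h) (leg13 A (leg23 V h) x) := by
  apply (isoW k A V W).injective
  have h1 := LinearMap.congr_fun (isoW_12 (V := V) h)
  have h2 := LinearMap.congr_fun (isoW_13 (V := V) h)
  have h3 := LinearMap.congr_fun (isoW_23 (V := V) (W := W) E)
  simp only [LinearMap.comp_apply, LinearEquiv.coe_coe] at h1 h2 h3
  rw [h1, h2, h3, h1, h2]
  have := LinearMap.congr_fun (congrArg (LinearMap.lTensor V) hn) (isoW k A V W x)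
  simpa only [LinearMap.lTensor_comp, LinearMap.comp_apply] using this

lemma coassoc_W (h : W ⊗[k] A →ₗ[k] W ⊗[k] A) (T : A ⊗[k] A →ₗ[k] A ⊗[k] A)
    (hn : leg12 A h ∘ₗ leg13 A h ∘ₗ leg23 W T = leg23 W T ∘ₗ leg12 A h)
    (x : V ⊗[k] W ⊗[k] A ⊗[k] A) :
    leg12 A (leg23 V h) (leg13 A (leg23 V h) (leg23 (V ⊗[k] W) T x)) =
    leg23 (V ⊗[k] W) T (leg12 A (leg23 V h) x) := by
  apply (isoW k A V W).injective
  have h1 := LinearMap.congr_fun (isoW_12 (V := V) h)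
  have h2 := LinearMap.congr_fun (isoW_13 (V := V) h)
  have h3 := LinearMap.congr_fun (isoW_23 (V := V) (W := W) T)
  simp only [LinearMap.comp_apply, LinearEquiv.coe_coe] at h1 h2 h3
  rw [h1, h2, h3, h3, h1]
  have := LinearMap.congr_fun (congrArg (LinearMap.lTensor V) hn) (isoW k A V W x)
  simpa only [LinearMap.lTensor_comp, LinearMap.comp_apply] using this

lemma coassoc_V (f : V ⊗[k] A →ₗ[k] V ⊗[k] A) (T : A ⊗[k] A →ₗ[k] A ⊗[k] A)
    (hn : leg12 A f ∘ₗ leg13 A f ∘ₗ leg23 V T = leg23 V T ∘ₗ leg12 A f)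
    (x : V ⊗[k] W ⊗[k] A ⊗[k] A) :
    leg12 A (leg13 W f) (leg13 A (leg13 W f) (leg23 (V ⊗[k] W) T x)) =
    leg23 (V ⊗[k] W) T (leg12 A (leg13 W f) x) := by
  apply (isoV k A V W).injective
  have h1 := LinearMap.congr_fun (isoV_12 (W := W) f)
  have h2 := LinearMap.congr_fun (isoV_13 (W := W) f)
  have h3 := LinearMap.congr_fun (isoV_23 (V := V) (W := W) T)
  simp only [LinearMap.comp_apply, LinearEquiv.coe_coe] at h1 h2 h3
  rw [h1, h2, h3, h3, h1]
  have := LinearMap.congr_fun (congrArg (LinearMap.rTensor W) hn) (isoV k A V W x)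
  simpa only [LinearMap.rTensor_comp, LinearMap.comp_apply] using this

end TensorAux

section Bialgebra

variable (k A : Type*) [Field k] [NonUnitalRing A] [Module k A] [IsScalarTower k A A]
  [SMulCommClass k A A]

/-- A weak multiplier bialgebra structure on a (possibly non-unital) associative algebra `A`.
With `L a`, `R a` the multiplications by `a` from the left and from the right, `(a ⊗ b) x` is
`map (L a) (L b) x`, `(a ⊗ 1) x` is `(L a ⊗ A) x`, `x (1 ⊗ b)` is `(A ⊗ R b) x`, and so on. -/
structure WeakMultiplierBialgebra where
  /-- `A` is idempotent. -/
  idempotent : Submodule.span k {x : A | ∃ a b : A, x = a * b} = ⊤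
  /-- `A` is non-degenerate. -/
  nondeg_left : ∀ a : A, (∀ b : A, a * b = 0) → a = 0
  nondeg_right : ∀ a : A, (∀ b : A, b * a = 0) → a = 0
  /-- `E₁ = E (-)`, `E₂ = (-) E` for the canonical idempotent multiplier `E`. -/
  E₁ : A ⊗[k] A →ₗ[k] A ⊗[k] A
  E₂ : A ⊗[k] A →ₗ[k] A ⊗[k] A
  /-- `T₁ (a ⊗ b) = Δ(a) (1 ⊗ b)`. -/
  T₁ : A ⊗[k] A →ₗ[k] A ⊗[k] A
  /-- `T₂ (a ⊗ b) = (a ⊗ 1) Δ(b)`. -/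
  T₂ : A ⊗[k] A →ₗ[k] A ⊗[k] A
  /-- The counit. -/
  ε : A →ₗ[k] k
  E_multiplier : ∀ a b c d : A,
    TensorProduct.map (LinearMap.mulLeft k a) (LinearMap.mulLeft k b) (E₁ (c ⊗ₜ d)) =
      TensorProduct.map (LinearMap.mulRight k c) (LinearMap.mulRight k d) (E₂ (a ⊗ₜ b))
  E_idem : E₁ ∘ₗ E₁ = E₁
  coassoc : leg12 A T₂ ∘ₗ leg23 A T₁ = leg23 A T₁ ∘ₗ leg12 A T₂
  counit_left : evalFst A ε ∘ₗ T₁ = LinearMap.mul' k A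
  counit_right : evalSnd A ε ∘ₗ T₂ = LinearMap.mul' k A
  comul_mul : (LinearMap.mul' k A).rTensor A ∘ₗ leg13 A T₁ ∘ₗ leg23 A T₁ =
    T₁ ∘ₗ (LinearMap.mul' k A).rTensor A
  span_left :
    Submodule.span k {x | ∃ a b c : A, x = (LinearMap.mulRight k b).rTensor A (T₁ (a ⊗ₜ c))} =
      Submodule.span k {x | ∃ b c : A, x = E₁ (b ⊗ₜ c)}
  span_right :
    Submodule.span k {x | ∃ a b c : A, x = (LinearMap.mulLeft k c).lTensor A (T₂ (b ⊗ₜ a))} =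
      Submodule.span k {x | ∃ b c : A, x = E₂ (b ⊗ₜ c)}
  E_comul : leg12 A E₁ ∘ₗ leg23 A T₁ = leg23 A T₁ ∘ₗ leg12 A E₁
  E_comul' : leg12 A E₂ ∘ₗ leg23 A T₂ = leg23 A T₂ ∘ₗ leg13 A E₂
  counit_E₁ : ∀ a b c : A,
    evalFst A ε ((LinearMap.mulLeft k a).lTensor A (E₁ (b ⊗ₜ c))) =
      evalFst A ε ((LinearMap.mulRight k b).rTensor A (T₁ (a ⊗ₜ c)))
  counit_E₂ : ∀ a b c : A,
    evalFst A ε ((LinearMap.mulRight k c).lTensor A (E₂ (a ⊗ₜ b))) =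
      evalFst A ε ((LinearMap.mulLeft k b).lTensor A (T₂ (a ⊗ₜ c)))

/-- A regular weak multiplier bialgebra structure on `A`; the maps `T₃ (a ⊗ b) = (1 ⊗ b) Δ(a)` and
`T₄ (a ⊗ b) = Δ(b) (a ⊗ 1)` are uniquely determined by the two last conditions. -/
structure RegularWeakMultiplierBialgebra extends WeakMultiplierBialgebra k A where
  T₃ : A ⊗[k] A →ₗ[k] A ⊗[k] A
  T₄ : A ⊗[k] A →ₗ[k] A ⊗[k] A
  regular₃ : ∀ a b c : A,
    (LinearMap.mulLeft k a).lTensor A (T₁ (c ⊗ₜ b)) =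
      (LinearMap.mulRight k b).lTensor A (T₃ (c ⊗ₜ a))
  regular₄ : ∀ a b c : A,
    (LinearMap.mulRight k b).rTensor A (T₂ (a ⊗ₜ c)) =
      (LinearMap.mulLeft k a).rTensor A (T₄ (b ⊗ₜ c))

end Bialgebra

section Base

variable {k A : Type*} [Field k] [NonUnitalRing A] [Module k A] [IsScalarTower k A A]
  [SMulCommClass k A A]

/-- The comultiplication is right full:
`⟨(A ⊗ ω) T₁ (a ⊗ b) | a, b ∈ A, ω ∈ Lin(A, k)⟩ = A`. -/
def RegularWeakMultiplierBialgebra.RightFull (B : RegularWeakMultiplierBialgebra k A) : Prop :=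
  Submodule.span k {x : A | ∃ (a b : A) (ω : A →ₗ[k] k), x = evalSnd A ω (B.T₁ (a ⊗ₜ b))} = ⊤

/-- The maps `⊓̄ᴿ : A → 𝕄(A)`, `⊓̄ᴿ(a) b = (A ⊗ ε) E₁ (b ⊗ a)`, `b ⊓̄ᴿ(a) = (A ⊗ ε) T₁ (b ⊗ a)`.
A multiplier on `A` is a pair of linear maps `A → A` (multiplication by it from the left, and
from the right), so `𝕄(A)` is a subset of the space of all such pairs. -/
def piBarR (B : RegularWeakMultiplierBialgebra k A) : A →ₗ[k] (A →ₗ[k] A) × (A →ₗ[k] A) :=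
  ((TensorProduct.mk k A A).compr₂ (evalSnd A B.ε ∘ₗ B.E₁)).flip.prod
    ((TensorProduct.mk k A A).compr₂ (evalSnd A B.ε ∘ₗ B.T₁)).flip

/-- The map `⊓ᴿ : A → 𝕄(A)`, `⊓ᴿ(a) b = (A ⊗ ε) T₃ (b ⊗ a)`, `b ⊓ᴿ(a) = (A ⊗ ε) E₂ (b ⊗ a)`. -/
def piR (B : RegularWeakMultiplierBialgebra k A) : A →ₗ[k] (A →ₗ[k] A) × (A →ₗ[k] A) :=
  ((TensorProduct.mk k A A).compr₂ (evalSnd A B.ε ∘ₗ B.T₃)).flip.prod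
    ((TensorProduct.mk k A A).compr₂ (evalSnd A B.ε ∘ₗ B.E₂)).flip

/-- The base algebra `R`, the range of `⊓ᴿ`; if the comultiplication is right full, this is also
the range of `⊓̄ᴿ`. -/
def base (B : RegularWeakMultiplierBialgebra k A) : Submodule k ((A →ₗ[k] A) × (A →ₗ[k] A)) :=
  LinearMap.range (piR B)

end Base

section Comodule

variable {k A : Type*} [Field k] [NonUnitalRing A] [Module k A] [IsScalarTower k A A]
  [SMulCommClass k A A]

/-- A right comodule structure over `B` on the vector space `V`. -/
@[ext]
structure RightComodule (B : RegularWeakMultiplierBialgebra k A) (V : Type*) [AddCommGroup V]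
    [Module k V] where
  lam : V ⊗[k] A →ₗ[k] V ⊗[k] A
  rho : V ⊗[k] A →ₗ[k] V ⊗[k] A
  /-- `(1 ⊗ a) λ(v ⊗ b) = ϱ(v ⊗ a) (1 ⊗ b)`. -/
  comp : ∀ (v : V) (a b : A),
    (LinearMap.mulLeft k a).lTensor V (lam (v ⊗ₜ b)) =
      (LinearMap.mulRight k b).lTensor V (rho (v ⊗ₜ a))
  /-- `(λ ⊗ A) λ¹³ (V ⊗ E₁) = (λ ⊗ A) λ¹³`. -/
  norm : leg12 A lam ∘ₗ leg13 A lam ∘ₗ leg23 V B.E₁ = leg12 A lam ∘ₗ leg13 A lam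
  /-- `(λ ⊗ A) λ¹³ (V ⊗ T₁) = (V ⊗ T₁) (λ ⊗ A)`. -/
  coassoc : leg12 A lam ∘ₗ leg13 A lam ∘ₗ leg23 V B.T₁ = leg23 V B.T₁ ∘ₗ leg12 A lam

variable {B : RegularWeakMultiplierBialgebra k A}
variable {V W : Type*} [AddCommGroup V] [Module k V] [AddCommGroup W] [Module k W]

/-- The comodule `V` is full: `V = ⟨(V ⊗ ω) λ(v ⊗ a) | v ∈ V, a ∈ A, ω ∈ Lin(A, k)⟩`. -/
def RightComodule.Full (C : RightComodule B V) : Prop :=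
  Submodule.span k {x : V | ∃ (v : V) (a : A) (ω : A →ₗ[k] k),
    x = evalSnd V ω (C.lam (v ⊗ₜ a))} = ⊤

/-- The linear map `f` is a morphism of comodules. -/
def IsComoduleHom (C : RightComodule B V) (D : RightComodule B W) (f : V →ₗ[k] W) : Prop :=
  D.lam ∘ₗ f.rTensor A = f.rTensor A ∘ₗ C.lam ∧ D.rho ∘ₗ f.rTensor A = f.rTensor A ∘ₗ C.rho

/-- For `r ∈ R`, the statement `v' = v r`, where the right action of `R` on a full comodule `V` is
`v ⊓̄ᴿ(a) = (V ⊗ ε) λ(v ⊗ a)`. -/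
def RightComodule.IsRightAction (C : RightComodule B V) (v : V)
    (r : (A →ₗ[k] A) × (A →ₗ[k] A)) (v' : V) : Prop :=
  ∃ a : A, r = piBarR B a ∧ v' = evalSnd V B.ε (C.lam (v ⊗ₜ a))

/-- For `r ∈ R`, the statement `v' = r v`, where the left action of `R` on a full comodule `V` is
`⊓ᴿ(a) v = (V ⊗ ε) ϱ(v ⊗ a)`. -/
def RightComodule.IsLeftAction (C : RightComodule B V) (r : (A →ₗ[k] A) × (A →ₗ[k] A)) (v : V)
    (v' : V) : Prop :=
  ∃ a : A, r = piR B a ∧ v' = evalSnd V B.ε (C.rho (v ⊗ₜ a))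

/-- The subspace of `V ⊗ W` spanned by the elements `v r ⊗ w - v ⊗ r w`, for `r ∈ R`. -/
def balanced (C : RightComodule B V) (D : RightComodule B W) : Submodule k (V ⊗[k] W) :=
  Submodule.span k {x | ∃ r ∈ base B, ∃ (v v' : V) (w w' : W),
    C.IsRightAction v r v' ∧ D.IsLeftAction r w w' ∧ x = v' ⊗ₜ[k] w - v ⊗ₜ[k] w'}

/-- The module tensor product `V ⊗_R W`. -/
abbrev BaseTensor (C : RightComodule B V) (D : RightComodule B W) : Type _ :=
  (V ⊗[k] W) ⧸ balanced C D

/-- The canonical projection `π : V ⊗ W → V ⊗_R W`. -/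
def baseProj (C : RightComodule B V) (D : RightComodule B W) :
    V ⊗[k] W →ₗ[k] BaseTensor C D :=
  (balanced C D).mkQ

/-- `a ↦ (1 ⊗ a) y` for `y ∈ W ⊗ A`. -/
def actFun (y : W ⊗[k] A) : A →ₗ[k] W ⊗[k] A :=
  (LinearMap.lTensorHom W ∘ₗ LinearMap.mul k A).flip y

lemma actFun_apply (y : W ⊗[k] A) (a : A) :
    actFun y a = (LinearMap.mulLeft k a).lTensor W y := rfl

lemma comp_aux (C : RightComodule B V) (v : V) (a : A) (y : W ⊗[k] A) :
    (LinearMap.mulLeft k a).lTensor (V ⊗[k] W)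
      (leg13 W C.lam ((TensorProduct.assoc k V W A).symm (v ⊗ₜ y))) =
    (TensorProduct.assoc k V W A).symm ((actFun y).lTensor V (C.rho (v ⊗ₜ a))) := by
  induction y with
  | zero => simp [actFun]
  | add y z hy hz =>
    have h : actFun (y + z) = actFun y + actFun z := by simp [actFun]
    rw [h, LinearMap.lTensor_add, TensorProduct.tmul_add]
    simp only [map_add, LinearMap.add_apply, hy, hz]
  | tmul w b =>
    have h1 : ∀ t : V ⊗[k] A, (LinearMap.mulLeft k a).lTensor (V ⊗[k] W)
        (TensorProduct.rightComm k V A W (t ⊗ₜ w)) =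
        TensorProduct.rightComm k V A W ((LinearMap.mulLeft k a).lTensor V t ⊗ₜ w) := by
      intro t
      induction t with
      | zero => simp
      | add y z hy hz => simp only [TensorProduct.add_tmul, map_add, hy, hz]
      | tmul x c => simp
    have h2 : ∀ t : V ⊗[k] A,
        TensorProduct.rightComm k V A W ((LinearMap.mulRight k b).lTensor V t ⊗ₜ w) =
        (TensorProduct.assoc k V W A).symm ((actFun (w ⊗ₜ b)).lTensor V t) := by
      intro t
      induction t with
      | zero => simp
      | add y z hy hz => simp only [TensorProduct.add_tmul, map_add, hy, hz]
      | tmul x c => simp [actFun_apply]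
    simp only [leg13, TensorProduct.assoc_symm_tmul, LinearMap.comp_apply,
      LinearEquiv.coe_coe, TensorProduct.rightComm_tmul, LinearMap.rTensor_tmul]
    rw [h1, C.comp, h2]

lemma comp_aux' (D : RightComodule B W) (w : W) (b : A) (z : V ⊗[k] A) :
    (TensorProduct.assoc k V W A).symm ((actFun (D.lam (w ⊗ₜ b))).lTensor V z) =
    (LinearMap.mulRight k b).lTensor (V ⊗[k] W)
      (leg23 V D.rho (TensorProduct.rightComm k V A W (z ⊗ₜ w))) := by
  induction z with
  | zero => simp
  | add y z hy hz => simp only [TensorProduct.add_tmul, map_add, hy, hz]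
  | tmul v a =>
    have h : ∀ t : W ⊗[k] A, (TensorProduct.assoc k V W A).symm
        (v ⊗ₜ (LinearMap.mulRight k b).lTensor W t) =
        (LinearMap.mulRight k b).lTensor (V ⊗[k] W)
          ((TensorProduct.assoc k V W A).symm (v ⊗ₜ t)) := by
      intro t
      induction t with
      | zero => simp
      | add y z hy hz => simp only [TensorProduct.tmul_add, map_add, hy, hz]
      | tmul x c => simp
    simp only [leg23, LinearMap.comp_apply, LinearEquiv.coe_coe,
      TensorProduct.rightComm_tmul, LinearMap.lTensor_tmul, actFun_apply,
      TensorProduct.assoc_tmul, D.comp, h]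

/-- The comodule `(V ⊗ W, λ_V¹³ (V ⊗ λ_W), (V ⊗ ϱ_W) ϱ_V¹³)`. -/
def RightComodule.tensor (C : RightComodule B V) (D : RightComodule B W) :
    RightComodule B (V ⊗[k] W) where
  lam := leg13 W C.lam ∘ₗ leg23 V D.lam
  rho := leg23 V D.rho ∘ₗ leg13 W C.rho
  comp := by
    intro x a b
    induction x with
    | zero => simp
    | add x y hx hy => simp only [TensorProduct.add_tmul, map_add, hx, hy]
    | tmul v w =>
      have h := comp_aux C v a (D.lam (w ⊗ₜ b))
      rw [comp_aux'] at h
      simpa [leg23, leg13] using h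
  norm := by
    apply LinearMap.ext; intro x
    simp only [LinearMap.comp_apply]
    rw [tensor_mul, tensor_mul, norm_W _ _ D.norm]
  coassoc := by
    apply LinearMap.ext; intro x
    simp only [LinearMap.comp_apply]
    rw [tensor_mul, coassoc_W _ _ D.coassoc, coassoc_V _ _ C.coassoc, leg12_comp]
    rfl

end Comodule

end WeakMultiplier

open scoped TensorProduct

namespace WeakMultiplier

/-! ### Functionals and jointly injective families separate tensors. -/

section Separation

variable {k : Type*} [Field k] {X Y Z : Type*} [AddCommGroup X] [Module k X] [AddCommGroup Y]
  [Module k Y] [AddCommGroup Z] [Module k Z]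

/-! Every r in R is a multiplier of A, and the coactions turn the actions of R on V and W into
multiplication by r in the leg A: λ(vr ⊗ b) = λ(v ⊗ rb) and λ(rw ⊗ b) = (1 ⊗ r) λ(w ⊗ b). Hence the
coaction of V ⊗ W takes the same value on vr ⊗ w and on v ⊗ rw, and likewise for ϱ. Both maps
descend to V ⊗_R W together with the comodule axioms, and uniquely, since the projection is
surjective.

The first rule (`DeltaComodule.lam_action`) rests on the left A-linearity of c ↦ c ⊓̄ᴿ(a)
(`DeltaSystem.ev_T₁_left`), a consequence of coassociativity and the counit axioms. With the
spanning condition for E, this linearity also makes ⊓̄ᴿ(a) a multiplier (`DeltaSystem.m_ev_E₁`). The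
rule for ϱ and ⊓ᴿ is the same statement over the opposite algebra. The arguments therefore run over
an abstract `DeltaSystem`; `deltaSystem` and `deltaSystemOp` are two instances, and exchanging λ and
ϱ turns a comodule over one into a comodule over the other. The mixed rules follow from the
compatibility of λ with ϱ.

For fullness, write λ(w ⊗ a) = ∑ wᵢ ⊗ aᵢ. The counit applied to the coaction of v ⊗ w ⊗ a gives ∑ v
⊓̄ᴿ(aᵢ) ⊗ wᵢ, which becomes v ⊗ ∑ ⊓̄ᴿ(aᵢ) wᵢ in V ⊗_R W; here right fullness is needed, to place
⊓̄ᴿ(aᵢ) in the range of ⊓ᴿ (`piBarR_mem_base`). Since the iterated coaction absorbs E, the vectors ∑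
⊓̄ᴿ(aᵢ) wᵢ and w ⊓̄ᴿ(a) have the same coaction (`lam_action_lam`). A vector of W with zero coaction
is killed by R, and V = VR, so it contributes nothing to V ⊗_R W (`baseProj_eq_zero`). Thus v ⊗ w
⊓̄ᴿ(a) lies in the span that defines fullness, and W = WR finishes the argument. -/

@[simp] lemma evalFst_tmul (ω : Y →ₗ[k] k) (y : Y) (x : X) : evalFst X ω (y ⊗ₜ x) = ω y • x := by
  simp [evalFst]

@[simp] lemma evalSnd_tmul (ω : Y →ₗ[k] k) (x : X) (y : Y) : evalSnd X ω (x ⊗ₜ y) = ω y • x := by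
  simp [evalSnd]

lemma eq_zero_of_evalFst (t : X ⊗[k] Y) (h : ∀ ω : X →ₗ[k] k, evalFst Y ω t = 0) : t = 0 := by
  classical
  apply (TensorProduct.equivFinsuppOfBasisLeft (N := Y) (Module.Basis.ofVectorSpace k X)).injective
  ext i
  rw [TensorProduct.equivFinsuppOfBasisLeft_apply]
  simpa [evalFst] using h ((Module.Basis.ofVectorSpace k X).coord i)

lemma eq_zero_of_evalSnd (t : X ⊗[k] Y) (h : ∀ ω : Y →ₗ[k] k, evalSnd X ω t = 0) : t = 0 := by
  classical
  apply (TensorProduct.equivFinsuppOfBasisRight (M := X) (Module.Basis.ofVectorSpace k Y)).injective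
  ext i
  rw [TensorProduct.equivFinsuppOfBasisRight_apply]
  simpa [evalSnd] using h ((Module.Basis.ofVectorSpace k Y).coord i)

lemma evalFst_lTensor (ω : X →ₗ[k] k) (f : Y →ₗ[k] Z) (t : X ⊗[k] Y) :
    evalFst Z ω (f.lTensor X t) = f (evalFst Y ω t) := by
  induction t with
  | zero => simp
  | add x y hx hy => simp only [map_add, hx, hy]
  | tmul x y => simp

lemma evalSnd_rTensor (ω : X →ₗ[k] k) (f : Y →ₗ[k] Z) (t : Y ⊗[k] X) :
    evalSnd Z ω (f.rTensor X t) = f (evalSnd Y ω t) := by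
  induction t with
  | zero => simp
  | add x y hx hy => simp only [map_add, hx, hy]
  | tmul x y => simp

lemma evalSnd_comp (ω : Z →ₗ[k] k) (f : Y →ₗ[k] Z) (t : X ⊗[k] Y) :
    evalSnd X (ω ∘ₗ f) t = evalSnd X ω (f.lTensor X t) := by
  induction t with
  | zero => simp
  | add x y hx hy => simp only [map_add, hx, hy]
  | tmul s t => simp

/-- Jointly injective linear maps stay jointly injective after tensoring from the left. -/
lemma eq_zero_of_lTensor {ι : Type*} (f : ι → Y →ₗ[k] Z) (hf : ∀ y, (∀ i, f i y = 0) → y = 0)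
    (t : X ⊗[k] Y) (h : ∀ i, (f i).lTensor X t = 0) : t = 0 :=
  eq_zero_of_evalFst t fun ω => hf _ fun i => by rw [← evalFst_lTensor, h, map_zero]

lemma eq_zero_of_rTensor {ι : Type*} (f : ι → Y →ₗ[k] Z) (hf : ∀ y, (∀ i, f i y = 0) → y = 0)
    (t : Y ⊗[k] X) (h : ∀ i, (f i).rTensor X t = 0) : t = 0 :=
  eq_zero_of_evalSnd t fun ω => hf _ fun i => by rw [← evalSnd_rTensor, h, map_zero]

lemma eq_of_lTensor {ι : Type*} (f : ι → Y →ₗ[k] Z) (hf : ∀ y, (∀ i, f i y = 0) → y = 0)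
    {s t : X ⊗[k] Y} (h : ∀ i, (f i).lTensor X s = (f i).lTensor X t) : s = t :=
  sub_eq_zero.1 (eq_zero_of_lTensor f hf _ fun i => by rw [map_sub, h, sub_self])

lemma eq_of_rTensor {ι : Type*} (f : ι → Y →ₗ[k] Z) (hf : ∀ y, (∀ i, f i y = 0) → y = 0)
    {s t : Y ⊗[k] X} (h : ∀ i, (f i).rTensor X s = (f i).rTensor X t) : s = t :=
  sub_eq_zero.1 (eq_zero_of_rTensor f hf _ fun i => by rw [map_sub, h, sub_self])

/-- Maps on different legs commute. -/
lemma rTensor_lTensor_comm {X' Y' : Type*} [AddCommGroup X'] [Module k X'] [AddCommGroup Y']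
    [Module k Y'] (f : X →ₗ[k] X') (g : Y →ₗ[k] Y') (t : X ⊗[k] Y) :
    f.rTensor Y' (g.lTensor X t) = g.lTensor X' (f.rTensor Y t) := by
  induction t with
  | zero => simp
  | add x y hx hy => simp only [map_add, hx, hy]
  | tmul x y => simp

end Separation

/-! ### Idempotent multipliers of A ⊗ A, in a form stable under passing to the opposite. -/

/-- A non-degenerate associative multiplication `m` with an idempotent multiplier `E`. The
multiplication is a field, so that the opposite system is available on the same vector space. -/
structure IdemSystem (k A : Type*) [Field k] [AddCommGroup A] [Module k A] where
  m : A →ₗ[k] A →ₗ[k] A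
  E₁ : A ⊗[k] A →ₗ[k] A ⊗[k] A
  E₂ : A ⊗[k] A →ₗ[k] A ⊗[k] A
  assoc : ∀ a b c, m (m a b) c = m a (m b c)
  nondeg_left : ∀ a, (∀ b, m a b = 0) → a = 0
  nondeg_right : ∀ a, (∀ b, m b a = 0) → a = 0
  E_mult : ∀ a b c d, TensorProduct.map (m a) (m b) (E₁ (c ⊗ₜ d)) =
    TensorProduct.map (m.flip c) (m.flip d) (E₂ (a ⊗ₜ b))
  E_idem : ∀ x, E₁ (E₁ x) = E₁ x

/-- The part of the data of a regular weak multiplier bialgebra that is needed for the properties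
of the map `⊓̄ᴿ`. -/
structure DeltaSystem (k A : Type*) [Field k] [AddCommGroup A] [Module k A] extends
    IdemSystem k A where
  T₁ : A ⊗[k] A →ₗ[k] A ⊗[k] A
  T₂ : A ⊗[k] A →ₗ[k] A ⊗[k] A
  ε : A →ₗ[k] k
  T_mult : ∀ a b c, (m a).rTensor A (T₁ (b ⊗ₜ c)) = (m.flip c).lTensor A (T₂ (a ⊗ₜ b))
  T₂_left : ∀ a b c, T₂ (m a b ⊗ₜ c) = (m a).rTensor A (T₂ (b ⊗ₜ c))
  coassoc : leg12 A T₂ ∘ₗ leg23 A T₁ = leg23 A T₁ ∘ₗ leg12 A T₂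
  counit : ∀ a b, evalSnd A ε (T₂ (a ⊗ₜ b)) = m a b
  -- The lifted map is s ⊗ t ↦ T₁(a ⊗ t)(s ⊗ 1), left multiplication by Δ(a); the field expresses
  -- Δ(ab) = Δ(a)Δ(b).
  T₁_mul : ∀ a b c, T₁ (m a b ⊗ₜ c) = TensorProduct.lift
    ((LinearMap.rTensorHom A ∘ₗ m.flip).compl₂ (T₁ ∘ₗ TensorProduct.mk k A A a)) (T₁ (b ⊗ₜ c))
  span : ∀ b c, E₁ (b ⊗ₜ c) ∈
    Submodule.span k {x | ∃ a b c : A, x = (m.flip b).rTensor A (T₁ (a ⊗ₜ c))}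
  E₁_T₁ : ∀ x, E₁ (T₁ x) = T₁ x
  E₂_T₂ : ∀ x, E₂ (T₂ x) = T₂ x
  counit_E₂ : ∀ a b c, evalFst A ε ((m.flip c).lTensor A (E₂ (a ⊗ₜ b))) =
    evalFst A ε ((m b).lTensor A (T₂ (a ⊗ₜ c)))

namespace IdemSystem

variable {k A : Type*} [Field k] [AddCommGroup A] [Module k A] (H : IdemSystem k A)

/-- The multiplication of `A ⊗ A`. -/
def mm : A ⊗[k] A →ₗ[k] A ⊗[k] A →ₗ[k] A ⊗[k] A := TensorProduct.map₂ H.m H.m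

@[simp] lemma mm_tmul (a b c d : A) : H.mm (a ⊗ₜ b) (c ⊗ₜ d) = H.m a c ⊗ₜ H.m b d := rfl

lemma mm_left (a b : A) (y : A ⊗[k] A) :
    H.mm (a ⊗ₜ b) y = TensorProduct.map (H.m a) (H.m b) y := by
  induction y with
  | zero => simp
  | add x y hx hy => simp only [map_add, hx, hy]
  | tmul x y => simp

lemma mm_right (a b : A) (y : A ⊗[k] A) :
    H.mm y (a ⊗ₜ b) = TensorProduct.map (H.m.flip a) (H.m.flip b) y := by
  induction y with
  | zero => simp
  | add x y hx hy => simp only [map_add, LinearMap.add_apply, hx, hy]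
  | tmul x y => simp

lemma map_eq (f g : A →ₗ[k] A) (y : A ⊗[k] A) :
    TensorProduct.map f g y = f.rTensor A (g.lTensor A y) := by
  rw [← LinearMap.comp_apply, LinearMap.rTensor_comp_lTensor]

lemma mm_assoc (x y z : A ⊗[k] A) : H.mm (H.mm x y) z = H.mm x (H.mm y z) := by
  induction x with
  | zero => simp
  | add x y hx hy => simp only [map_add, LinearMap.add_apply, hx, hy]
  | tmul a b =>
  induction y with
  | zero => simp
  | add x y hx hy => simp only [map_add, LinearMap.add_apply, hx, hy]
  | tmul c d =>
  induction z with
  | zero => simp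
  | add x y hx hy => simp only [map_add, hx, hy]
  | tmul e f => simp [H.assoc]

/-- Left multiplications are jointly injective on A, and stay so on each leg of a tensor product, so
the two legs can be cancelled one at a time. -/
lemma mm_nondeg_right (y : A ⊗[k] A) (h : ∀ x, H.mm x y = 0) : y = 0 := by
  refine eq_zero_of_lTensor H.m (fun y hy => H.nondeg_right y hy) _ fun b => ?_
  refine eq_zero_of_rTensor H.m (fun y hy => H.nondeg_right y hy) _ fun a => ?_
  rw [← map_eq, ← mm_left, h]

lemma mm_nondeg_left (y : A ⊗[k] A) (h : ∀ x, H.mm y x = 0) : y = 0 := by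
  refine eq_zero_of_lTensor H.m.flip (fun y hy => H.nondeg_left y hy) _ fun b => ?_
  refine eq_zero_of_rTensor H.m.flip (fun y hy => H.nondeg_left y hy) _ fun a => ?_
  rw [← map_eq, ← mm_right, h]

lemma mm_ext_right {y z : A ⊗[k] A} (h : ∀ x, H.mm x y = H.mm x z) : y = z :=
  sub_eq_zero.1 (H.mm_nondeg_right _ fun x => by rw [map_sub, h, sub_self])

lemma mm_ext_left {y z : A ⊗[k] A} (h : ∀ x, H.mm y x = H.mm z x) : y = z :=
  sub_eq_zero.1 (H.mm_nondeg_left _ fun x => by rw [map_sub, LinearMap.sub_apply, h, sub_self])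

lemma E_mm (x y : A ⊗[k] A) : H.mm x (H.E₁ y) = H.mm (H.E₂ x) y := by
  induction x with
  | zero => simp
  | add x y hx hy => simp only [map_add, LinearMap.add_apply, hx, hy]
  | tmul a b =>
  induction y with
  | zero => simp
  | add x y hx hy => simp only [map_add, hx, hy]
  | tmul c d => rw [mm_left, mm_right, H.E_mult]

lemma m_comp (a b : A) : H.m (H.m a b) = H.m a ∘ₗ H.m b := by ext; simp [H.assoc]

lemma m_flip_comp (a b : A) : H.m.flip (H.m a b) = H.m.flip b ∘ₗ H.m.flip a := by
  ext; simp [H.assoc]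

lemma m_flip_comm (a b : A) : H.m.flip b ∘ₗ H.m a = H.m a ∘ₗ H.m.flip b := by
  ext; simp [H.assoc]

lemma rTensor_flip_flip {X : Type*} [AddCommGroup X] [Module k X] (a b : A) (z : A ⊗[k] X) :
    (H.m.flip b).rTensor X ((H.m.flip a).rTensor X z) = (H.m.flip (H.m a b)).rTensor X z := by
  rw [m_flip_comp, LinearMap.rTensor_comp_apply]

lemma lTensor_flip_flip {X : Type*} [AddCommGroup X] [Module k X] (a b : A) (z : X ⊗[k] A) :
    (H.m.flip b).lTensor X ((H.m.flip a).lTensor X z) = (H.m.flip (H.m a b)).lTensor X z := by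
  rw [m_flip_comp, LinearMap.lTensor_comp_apply]

lemma rTensor_flip_comm {X : Type*} [AddCommGroup X] [Module k X] (a b : A) (z : A ⊗[k] X) :
    (H.m.flip b).rTensor X ((H.m a).rTensor X z) = (H.m a).rTensor X ((H.m.flip b).rTensor X z) := by
  rw [← LinearMap.rTensor_comp_apply, m_flip_comm, LinearMap.rTensor_comp_apply]

lemma lTensor_flip_comm {X : Type*} [AddCommGroup X] [Module k X] (a b : A) (z : X ⊗[k] A) :
    (H.m.flip b).lTensor X ((H.m a).lTensor X z) = (H.m a).lTensor X ((H.m.flip b).lTensor X z) := by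
  rw [← LinearMap.lTensor_comp_apply, m_flip_comm, LinearMap.lTensor_comp_apply]

lemma lTensor_mm (t : A) (z w : A ⊗[k] A) :
    H.mm ((H.m t).lTensor A z) w = (H.m t).lTensor A (H.mm z w) := by
  induction z with
  | zero => simp
  | add x y hx hy => simp only [map_add, LinearMap.add_apply, hx, hy]
  | tmul a b =>
    rw [LinearMap.lTensor_tmul, mm_left, mm_left, map_eq, map_eq, m_comp,
      LinearMap.lTensor_comp_apply, rTensor_lTensor_comm]

lemma mm_rTensor (t : A) (z w : A ⊗[k] A) :
    H.mm w ((H.m.flip t).rTensor A z) = (H.m.flip t).rTensor A (H.mm w z) := by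
  induction z with
  | zero => simp
  | add x y hx hy => simp only [map_add, hx, hy]
  | tmul a b =>
    rw [LinearMap.rTensor_tmul, mm_right, mm_right, map_eq, map_eq, LinearMap.flip_apply,
      rTensor_flip_flip]

/-- Right multiplication by E commutes with left multiplications: testing against w moves E onto w,
where it no longer meets t. -/
lemma E₂_lTensor (t : A) (z : A ⊗[k] A) :
    H.E₂ ((H.m t).lTensor A z) = (H.m t).lTensor A (H.E₂ z) :=
  H.mm_ext_left fun w => by rw [← E_mm, lTensor_mm, lTensor_mm, E_mm]

lemma E₁_rTensor (t : A) (z : A ⊗[k] A) :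
    H.E₁ ((H.m.flip t).rTensor A z) = (H.m.flip t).rTensor A (H.E₁ z) :=
  H.mm_ext_right fun w => by rw [E_mm, mm_rTensor, mm_rTensor, E_mm]

lemma E₂_idem (x : A ⊗[k] A) : H.E₂ (H.E₂ x) = H.E₂ x :=
  H.mm_ext_left fun z => by rw [← E_mm, ← E_mm, E_idem, E_mm]

/-- The opposite system. -/
def op : IdemSystem k A where
  m := H.m.flip
  E₁ := H.E₂
  E₂ := H.E₁
  assoc a b c := (H.assoc c b a).symm
  nondeg_left := H.nondeg_right
  nondeg_right := H.nondeg_left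
  E_mult a b c d := (H.E_mult c d a b).symm
  E_idem := H.E₂_idem

lemma E₁_of_mem_span {y : A ⊗[k] A}
    (hy : y ∈ Submodule.span k {y | ∃ c d : A, y = H.E₁ (c ⊗ₜ d)}) : H.E₁ y = y := by
  induction hy using Submodule.span_induction with
  | zero => simp
  | add x y _ _ hx hy => simp only [map_add, hx, hy]
  | smul c x _ hx => simp only [map_smul, hx]
  | mem w hw => obtain ⟨c, d, rfl⟩ := hw; rw [E_idem]

/-- If `x (b ⊗ 1)` is in the range of `E` for all `b`, then `E x = x`. -/
lemma E₁_eq_self {x : A ⊗[k] A}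
    (h : ∀ b, (H.m.flip b).rTensor A x ∈ Submodule.span k {y | ∃ c d : A, y = H.E₁ (c ⊗ₜ d)}) :
    H.E₁ x = x :=
  eq_of_rTensor H.m.flip (fun y hy => H.nondeg_left y hy) fun b => by
    rw [← E₁_rTensor, H.E₁_of_mem_span (h b)]

/-- If `(1 ⊗ b) x` is in the range of `E` for all `b`, then `x E = x`. -/
lemma E₂_eq_self {x : A ⊗[k] A}
    (h : ∀ b, (H.m b).lTensor A x ∈ Submodule.span k {y | ∃ c d : A, y = H.E₂ (c ⊗ₜ d)}) :
    H.E₂ x = x :=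
  eq_of_lTensor H.m (fun y hy => H.nondeg_right y hy) fun b => by
    rw [← E₂_lTensor]; exact H.op.E₁_of_mem_span (h b)

end IdemSystem

/-! ### The multiplier Δ(a), and the proof that ⊓̄ᴿ(a) is a multiplier. -/

namespace DeltaSystem

open IdemSystem

variable {k A : Type*} [Field k] [AddCommGroup A] [Module k A] (H : DeltaSystem k A)

/-- Left multiplication by `Δ(a)`. -/
def comulL (a : A) : A ⊗[k] A →ₗ[k] A ⊗[k] A := TensorProduct.lift
    ((LinearMap.rTensorHom A ∘ₗ H.m.flip).compl₂ (H.T₁ ∘ₗ TensorProduct.mk k A A a))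

@[simp] lemma comulL_tmul (a s t : A) :
    H.comulL a (s ⊗ₜ t) = (H.m.flip s).rTensor A (H.T₁ (a ⊗ₜ t)) := rfl

/-- Right multiplication by `Δ(a)`. -/
def comulR (a : A) : A ⊗[k] A →ₗ[k] A ⊗[k] A := TensorProduct.lift
    ((LinearMap.lTensorHom A ∘ₗ H.m).compl₂ (H.T₂ ∘ₗ (TensorProduct.mk k A A).flip a)).flip

@[simp] lemma comulR_tmul (a s t : A) :
    H.comulR a (s ⊗ₜ t) = (H.m t).lTensor A (H.T₂ (s ⊗ₜ a)) := rfl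

lemma T₁_mul' (a b c : A) : H.T₁ (H.m a b ⊗ₜ c) = H.comulL a (H.T₁ (b ⊗ₜ c)) := H.T₁_mul a b c

lemma comul_mm_tmul (a p s t : A) (q : A) :
    H.mm (p ⊗ₜ q) (H.comulL a (s ⊗ₜ t)) = H.mm (H.comulR a (p ⊗ₜ q)) (s ⊗ₜ t) := by
  rw [mm_left, mm_right, comulL_tmul, comulR_tmul, map_eq, map_eq, ← rTensor_lTensor_comm,
    ← rTensor_flip_comm, rTensor_lTensor_comm _ _ (H.T₁ _), H.T_mult, lTensor_flip_comm]

/-- This is what makes `comulL a` and `comulR a` the two sides of one multiplier Δ(a). By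
non-degeneracy, an identity for one side then yields its counterpart for the other. -/
lemma comul_mm (a : A) (x y : A ⊗[k] A) : H.mm x (H.comulL a y) = H.mm (H.comulR a x) y := by
  induction x with
  | zero => simp
  | add x y hx hy => simp only [map_add, LinearMap.add_apply, hx, hy]
  | tmul p q =>
  induction y with
  | zero => simp
  | add x y hx hy => simp only [map_add, hx, hy]
  | tmul s t => exact H.comul_mm_tmul a p s t q

lemma comulR_mm (a : A) (x y : A ⊗[k] A) : H.comulR a (H.mm x y) = H.mm x (H.comulR a y) :=
  H.mm_ext_left fun z => by rw [← comul_mm, mm_assoc, comul_mm, ← mm_assoc]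

lemma comulL_rTensor (a s : A) (z : A ⊗[k] A) : H.comulL a ((H.m.flip s).rTensor A z) =
    (H.m.flip s).rTensor A (H.comulL a z) := by
  induction z with
  | zero => simp
  | add x y hx hy => simp only [map_add, hx, hy]
  | tmul u v => rw [LinearMap.rTensor_tmul, comulL_tmul, comulL_tmul, rTensor_flip_flip]; rfl

lemma comulL_mul (a b : A) (y : A ⊗[k] A) : H.comulL (H.m a b) y = H.comulL a (H.comulL b y) := by
  induction y with
  | zero => simp
  | add x y hx hy => simp only [map_add, hx, hy]
  | tmul s t => rw [comulL_tmul, comulL_tmul, T₁_mul', comulL_rTensor]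

lemma comulR_mul (a b : A) (y : A ⊗[k] A) : H.comulR (H.m a b) y = H.comulR b (H.comulR a y) :=
  H.mm_ext_left fun z => by rw [← comul_mm, comulL_mul, comul_mm, comul_mm]

/-- The map `A ⊗ ε`. -/
abbrev ev : A ⊗[k] A →ₗ[k] A := evalSnd A H.ε

lemma ev_m_rTensor (a : A) (z : A ⊗[k] A) : H.ev ((H.m a).rTensor A z) = H.m a (H.ev z) :=
  evalSnd_rTensor _ _ _

lemma ev_flip_rTensor (a : A) (z : A ⊗[k] A) :
    H.ev ((H.m.flip a).rTensor A z) = H.m (H.ev z) a :=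
  evalSnd_rTensor _ _ _

/-- Multiplication by q ⊗ t from the left turns T₂ into right multiplication by Δ on a pure tensor,
where the claim is Δ(cs) = Δ(c)Δ(s). -/
lemma comulR_T₂ (p c s : A) : H.T₂ (p ⊗ₜ H.m c s) = H.comulR s (H.T₂ (p ⊗ₜ c)) := by
  refine eq_of_rTensor H.m (fun y hy => H.nondeg_right y hy) fun q => ?_
  refine eq_of_lTensor H.m (fun y hy => H.nondeg_right y hy) fun t => ?_
  have h : ∀ z, (H.m t).lTensor A ((H.m q).rTensor A (H.comulR s z)) =
      H.comulR s ((H.m t).lTensor A ((H.m q).rTensor A z)) := by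
    intro z
    rw [← rTensor_lTensor_comm, ← map_eq, ← mm_left, ← comulR_mm, mm_left, map_eq,
      rTensor_lTensor_comm]
  rw [h, ← T₂_left, ← T₂_left, ← comulR_tmul, ← comulR_tmul, comulR_mul]

/-- `ε(rty) = (ε ⊗ ε)((r ⊗ 1) Δ(t) (1 ⊗ y))`. -/
lemma counit_triple (r t y : A) : H.ε (H.m r (H.m t y)) =
    H.ε (evalFst A H.ε ((H.m r).rTensor A (H.T₁ (t ⊗ₜ y)))) := by
  -- After left multiplication by b, `counit_E₂` turns the left side into (ε ⊗ A)((r ⊗ b)E(1 ⊗ ty)),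
  -- from which y visibly factors out on the right.
  have h : evalFst A H.ε (H.T₂ (r ⊗ₜ H.m t y)) = H.m (evalFst A H.ε (H.T₂ (r ⊗ₜ t))) y := by
    rw [← sub_eq_zero]
    refine H.nondeg_right _ fun b => ?_
    rw [map_sub, ← H.assoc, ← evalFst_lTensor, ← evalFst_lTensor, ← H.counit_E₂, ← H.counit_E₂,
      ← lTensor_flip_flip, evalFst_lTensor (f := H.m.flip y), LinearMap.flip_apply, sub_self]
  have e : ∀ z : A ⊗[k] A, H.ε (evalFst A H.ε z) = H.ε (evalSnd A H.ε z) := by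
    intro z
    induction z with
    | zero => simp
    | add x y hx hy => simp only [map_add, hx, hy]
    | tmul u v => simp [mul_comm]
  rw [H.T_mult, evalFst_lTensor, LinearMap.flip_apply, ← h, e, H.counit]

/-- `(A ⊗ ε)(x Δ(a) (1 ⊗ b)) = (A ⊗ ε)(x Δ(a'))` for `a' = (A ⊗ ε)(Δ(a) (1 ⊗ b))`. -/
lemma ev_mm_T₁ (x : A ⊗[k] A) (a b : A) :
    H.ev (H.mm x (H.T₁ (a ⊗ₜ b))) = H.ev (H.comulR (H.ev (H.T₁ (a ⊗ₜ b))) x) := by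
  induction x with
  | zero => simp
  | add x y hx hy => simp only [map_add, LinearMap.add_apply, hx, hy]
  | tmul q r =>
  -- For x = q ⊗ r, `counit_triple` replaces the single counit by two, which inserts T₁ on the last
  -- two legs and prepares coassociativity. It is used with z = T₂(q ⊗ a).
  have h1 : ∀ z : A ⊗[k] A, H.ev ((H.m r).lTensor A ((H.m.flip b).lTensor A z)) =
      H.ev (evalSnd (A ⊗[k] A) H.ε ((((H.m r).lTensor A).rTensor A) (leg23 A H.T₁ (z ⊗ₜ b)))) := by
    intro z
    induction z with
    | zero => simp
    | add x y hx hy => simp only [map_add, TensorProduct.add_tmul, hx, hy]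
    | tmul g h =>
      have e : ∀ w : A ⊗[k] A, H.ev (evalSnd (A ⊗[k] A) H.ε ((((H.m r).lTensor A).rTensor A)
          ((TensorProduct.assoc k A A A).symm (g ⊗ₜ w)))) =
          H.ε (evalFst A H.ε ((H.m r).rTensor A w)) • g := by
        intro w
        induction w with
        | zero => simp
        | add x y hx hy => simp only [map_add, TensorProduct.tmul_add, add_smul, hx, hy]
        | tmul g h => simp [smul_smul, mul_comm]
      simp only [leg23, LinearMap.comp_apply, LinearEquiv.coe_coe, TensorProduct.assoc_tmul,
        LinearMap.lTensor_tmul, e, ← counit_triple, LinearMap.flip_apply, evalSnd_tmul]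
  -- The other side of coassociativity, used with z = T₁(a ⊗ b): the counit on the third leg meets
  -- only z.
  have h2 : ∀ z : A ⊗[k] A, H.ev (evalSnd (A ⊗[k] A) H.ε ((((H.m r).lTensor A).rTensor A)
      (leg12 A H.T₂ ((TensorProduct.assoc k A A A).symm (q ⊗ₜ z))))) =
      H.ev (H.comulR (H.ev z) (q ⊗ₜ r)) := by
    intro z
    simp only [comulR_tmul]
    induction z with
    | zero => simp
    | add x y hx hy => simp only [map_add, TensorProduct.tmul_add, hx, hy]
    | tmul g h => simp [leg12]
  rw [mm_left, map_eq, rTensor_lTensor_comm, H.T_mult, h1, ← h2]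
  have := LinearMap.congr_fun H.coassoc (q ⊗ₜ a ⊗ₜ b)
  simp only [LinearMap.comp_apply] at this
  have e2 : leg12 A H.T₂ (q ⊗ₜ a ⊗ₜ b) = H.T₂ (q ⊗ₜ a) ⊗ₜ b := by simp [leg12]
  have e3 : leg23 A H.T₁ (q ⊗ₜ a ⊗ₜ b) =
    (TensorProduct.assoc k A A A).symm (q ⊗ₜ H.T₁ (a ⊗ₜ b)) := by simp [leg23]
  rw [← e2, ← this, e3]

/-- The map `c ↦ (A ⊗ ε)(Δ(c) (1 ⊗ a))` is left `A`-linear. -/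
lemma ev_T₁_left (c x y : A) : H.ev (H.T₁ (H.m c x ⊗ₜ y)) = H.m c (H.ev (H.T₁ (x ⊗ₜ y))) := by
  rw [← sub_eq_zero]
  refine H.nondeg_right _ fun p => ?_
  -- (p ⊗ 1)Δ(c) is the honest tensor T₂(p ⊗ c), so `ev_mm_T₁` applies. With x' = (A ⊗ ε)T₁(x ⊗ y)
  -- it leaves (A ⊗ ε)T₂(p ⊗ cx') = p(cx').
  have h : ∀ z, (H.m p).rTensor A (H.comulL c z) = H.mm (H.T₂ (p ⊗ₜ c)) z := by
    intro z
    induction z with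
    | zero => simp
    | add x y hx hy => simp only [map_add, hx, hy]
    | tmul s t => rw [mm_right, map_eq, ← H.T_mult, comulL_tmul, rTensor_flip_comm]
  rw [map_sub, ← ev_m_rTensor, T₁_mul', h, ev_mm_T₁, ← comulR_T₂, H.counit, sub_self]

/-- `b ((A ⊗ ε)(E z)) = (A ⊗ ε)(Δ(b) z)`. -/
lemma m_ev_E₁ (b : A) (z : A ⊗[k] A) : H.m b (H.ev (H.E₁ z)) = H.ev (H.comulL b z) := by
  -- On T₁(x ⊗ y)(s ⊗ 1) the claim reduces to left linearity, because Δ(b)Δ(x) = Δ(bx). The range of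
  -- E lies in the span of these elements.
  have h1 : ∀ w ∈ Submodule.span k {x | ∃ a b c : A, x = (H.m.flip b).rTensor A (H.T₁ (a ⊗ₜ c))},
      H.m b (H.ev w) = H.ev (H.comulL b w) := by
    intro w hw
    induction hw using Submodule.span_induction with
    | zero => simp
    | add x y _ _ hx hy => simp only [map_add, hx, hy]
    | smul c x _ hx => simp only [map_smul, hx]
    | mem w hw =>
      obtain ⟨x, s, y, rfl⟩ := hw
      rw [ev_flip_rTensor, comulL_rTensor, ← T₁_mul', ev_flip_rTensor, ev_T₁_left, H.assoc]
  have h2 : H.E₁ z ∈ Submodule.span k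
      {x | ∃ a b c : A, x = (H.m.flip b).rTensor A (H.T₁ (a ⊗ₜ c))} := by
    induction z with
    | zero => simp
    | add x y hx hy => rw [map_add]; exact add_mem hx hy
    | tmul s t => exact H.span s t
  -- Δ(b)E = Δ(b), which allows E to be dropped from Δ(b)(Ez) at the end.
  have h3 : ∀ x, H.E₂ (H.comulR b x) = H.comulR b x := by
    intro x
    induction x with
    | zero => simp
    | add x y hx hy => simp only [map_add, hx, hy]
    | tmul s t => rw [comulR_tmul, E₂_lTensor, E₂_T₂]
  rw [h1 _ h2]
  congr 1
  exact H.mm_ext_right fun x => by rw [comul_mm, E_mm, h3, comul_mm]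

end DeltaSystem

end WeakMultiplier

/-! ### The four maps T of a regular weak multiplier bialgebra, and its two systems. -/

namespace WeakMultiplier

namespace RegularWeakMultiplierBialgebra

open LinearMap

variable {k A : Type*} [Field k] [NonUnitalRing A] [Module k A] [IsScalarTower k A A]
  [SMulCommClass k A A] (B : RegularWeakMultiplierBialgebra k A)

/-- The multiplication of `A` with the idempotent multiplier `E`. -/
def idem : IdemSystem k A where
  m := LinearMap.mul k A
  E₁ := B.E₁
  E₂ := B.E₂
  assoc := mul_assoc
  nondeg_left := B.nondeg_left
  nondeg_right := B.nondeg_right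
  E_mult := B.E_multiplier
  E_idem := LinearMap.congr_fun B.E_idem

section

variable {X : Type*} [AddCommGroup X] [Module k X]

lemma ext_mulLeft_lTensor (B : RegularWeakMultiplierBialgebra k A) {s t : X ⊗[k] A}
    (h : ∀ a, (mulLeft k a).lTensor X s = (mulLeft k a).lTensor X t) : s = t :=
  eq_of_lTensor _ B.nondeg_right h

lemma ext_mulRight_lTensor (B : RegularWeakMultiplierBialgebra k A) {s t : X ⊗[k] A}
    (h : ∀ a, (mulRight k a).lTensor X s = (mulRight k a).lTensor X t) : s = t :=
  eq_of_lTensor _ B.nondeg_left h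

lemma ext_mulLeft_rTensor (B : RegularWeakMultiplierBialgebra k A) {s t : A ⊗[k] X}
    (h : ∀ a, (mulLeft k a).rTensor X s = (mulLeft k a).rTensor X t) : s = t :=
  eq_of_rTensor _ B.nondeg_right h

lemma ext_mulRight_rTensor (B : RegularWeakMultiplierBialgebra k A) {s t : A ⊗[k] X}
    (h : ∀ a, (mulRight k a).rTensor X s = (mulRight k a).rTensor X t) : s = t :=
  eq_of_rTensor _ B.nondeg_left h

lemma ext_mulLeft (B : RegularWeakMultiplierBialgebra k A) {s t : A} (h : ∀ a, a * s = a * t) :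
    s = t :=
  sub_eq_zero.1 (B.nondeg_right _ fun a => by rw [mul_sub, h, sub_self])

lemma ext_mulRight (B : RegularWeakMultiplierBialgebra k A) {s t : A} (h : ∀ a, s * a = t * a) :
    s = t :=
  sub_eq_zero.1 (B.nondeg_left _ fun a => by rw [sub_mul, h, sub_self])

end

end RegularWeakMultiplierBialgebra

section Mul

open LinearMap

variable {k A : Type*} [Field k] [NonUnitalRing A] [Module k A] {X : Type*} [AddCommGroup X] [Module k X]

lemma lTensor_mulRight_mulLeft [IsScalarTower k A A] [SMulCommClass k A A] (a b : A)
    (z : X ⊗[k] A) :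
    (mulRight k b).lTensor X ((mulLeft k a).lTensor X z) =
      (mulLeft k a).lTensor X ((mulRight k b).lTensor X z) := by
  rw [← lTensor_comp_apply, ← lTensor_comp_apply]; congr 2; ext; simp [mul_assoc]

lemma rTensor_mulRight_mulLeft [IsScalarTower k A A] [SMulCommClass k A A] (a b : A)
    (z : A ⊗[k] X) :
    (mulRight k b).rTensor X ((mulLeft k a).rTensor X z) =
      (mulLeft k a).rTensor X ((mulRight k b).rTensor X z) := by
  rw [← rTensor_comp_apply, ← rTensor_comp_apply]; congr 2; ext; simp [mul_assoc]

lemma rTensor_mulLeft_mul [SMulCommClass k A A] (a b : A)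
    (z : A ⊗[k] X) :
    (mulLeft k (a * b)).rTensor X z = (mulLeft k a).rTensor X ((mulLeft k b).rTensor X z) := by
  rw [← rTensor_comp_apply]; congr 2; ext; simp

lemma lTensor_mulRight_mul [IsScalarTower k A A] (a b : A) (z : X ⊗[k] A) :
    (mulRight k (a * b)).lTensor X z = (mulRight k b).lTensor X ((mulRight k a).lTensor X z) := by
  rw [← lTensor_comp_apply]; congr 2; ext; simp [mul_assoc]

lemma rTensor_mulRight_mul [IsScalarTower k A A] (a b : A) (z : A ⊗[k] X) :
    (mulRight k (a * b)).rTensor X z = (mulRight k b).rTensor X ((mulRight k a).rTensor X z) := by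
  rw [← rTensor_comp_apply]; congr 2; ext; simp [mul_assoc]

end Mul

section Legs

variable {k : Type*} [Field k] {X Y Z X' Y' Z' : Type*} [AddCommGroup X] [Module k X]
  [AddCommGroup Y] [Module k Y] [AddCommGroup Z] [Module k Z] [AddCommGroup X'] [Module k X']
  [AddCommGroup Y'] [Module k Y'] [AddCommGroup Z'] [Module k Z']

lemma leg12_tmul (f : X ⊗[k] Y →ₗ[k] X' ⊗[k] Y') (t : X ⊗[k] Y) (z : Z) :
    leg12 Z f (t ⊗ₜ z) = f t ⊗ₜ z := rfl

lemma leg23_tmul (f : Y ⊗[k] Z →ₗ[k] Y' ⊗[k] Z') (x : X) (y : Y) (z : Z) :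
    leg23 X f (x ⊗ₜ y ⊗ₜ z) = (TensorProduct.assoc k X Y' Z').symm (x ⊗ₜ f (y ⊗ₜ z)) := rfl

lemma leg23_assoc_symm (f : Y ⊗[k] Z →ₗ[k] Y' ⊗[k] Z') (x : X) (t : Y ⊗[k] Z) :
    leg23 X f ((TensorProduct.assoc k X Y Z).symm (x ⊗ₜ t)) =
      (TensorProduct.assoc k X Y' Z').symm (x ⊗ₜ f t) := by
  simp [leg23]

lemma leg13_tmul (f : X ⊗[k] Z →ₗ[k] X' ⊗[k] Z') (x : X) (y : Y) (z : Z) :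
    leg13 Y f (x ⊗ₜ y ⊗ₜ z) = TensorProduct.rightComm k X' Z' Y (f (x ⊗ₜ z) ⊗ₜ y) := rfl

/-- `(X ⊗ ω ⊗ Z') (X ⊗ T)`. -/
lemma evalSnd_leg23 {T : Y ⊗[k] Z →ₗ[k] Y' ⊗[k] Z'} {ω : Y' →ₗ[k] k} {f : Y →ₗ[k] Z'} {c : Z}
    (h : ∀ a, evalFst Z' ω (T (a ⊗ₜ c)) = f a) (t : X ⊗[k] Y) :
    (evalSnd X ω).rTensor Z' (leg23 X T (t ⊗ₜ c)) = f.lTensor X t := by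
  induction t with
  | zero => simp
  | add x y hx hy => simp only [map_add, TensorProduct.add_tmul, hx, hy]
  | tmul s t =>
    have e : ∀ w : Y' ⊗[k] Z', (evalSnd X ω).rTensor Z'
        ((TensorProduct.assoc k X Y' Z').symm (s ⊗ₜ w)) = s ⊗ₜ evalFst Z' ω w := by
      intro w
      induction w with
      | zero => simp
      | add x y hx hy => simp only [map_add, TensorProduct.tmul_add, hx, hy]
      | tmul u v => simp [TensorProduct.smul_tmul]
    rw [leg23_tmul, e, h, LinearMap.lTensor_tmul]

end Legs

namespace RegularWeakMultiplierBialgebra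

open LinearMap

variable {k A : Type*} [Field k] [NonUnitalRing A] [Module k A] [IsScalarTower k A A]
  [SMulCommClass k A A] (B : RegularWeakMultiplierBialgebra k A)

lemma T₂_left (a b c : A) : B.T₂ ((c * a) ⊗ₜ b) = (mulLeft k c).rTensor A (B.T₂ (a ⊗ₜ b)) :=
  B.ext_mulRight_rTensor fun d => by
    rw [B.regular₄, rTensor_mulLeft_mul, rTensor_mulRight_mulLeft, B.regular₄]

lemma T₄_right (a b c : A) : B.T₄ ((a * c) ⊗ₜ b) = (mulRight k c).rTensor A (B.T₄ (a ⊗ₜ b)) :=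
  B.ext_mulLeft_rTensor fun d => by
    rw [← B.regular₄, rTensor_mulRight_mul, ← rTensor_mulRight_mulLeft, B.regular₄]

lemma evalFst_T₁ (a b : A) : evalFst A B.ε (B.T₁ (a ⊗ₜ b)) = a * b :=
  LinearMap.congr_fun B.counit_left (a ⊗ₜ b)

lemma evalSnd_T₂ (a b : A) : evalSnd A B.ε (B.T₂ (a ⊗ₜ b)) = a * b :=
  LinearMap.congr_fun B.counit_right (a ⊗ₜ b)

lemma evalSnd_leg23_T₁ {X : Type*} [AddCommGroup X] [Module k X] (z : X ⊗[k] A) (c : A) :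
    (evalSnd X B.ε).rTensor A (leg23 X B.T₁ (z ⊗ₜ c)) = (mulRight k c).lTensor X z :=
  evalSnd_leg23 (fun a => B.evalFst_T₁ a c) z

/-- Applying ε to the middle leg of coassociativity collapses one side to (a ⊗ 1)T₁(b ⊗ c) and the
other to T₂(a ⊗ b)(1 ⊗ c). -/
lemma T₁_T₂ (a b c : A) : (mulLeft k a).rTensor A (B.T₁ (b ⊗ₜ c)) =
    (mulRight k c).lTensor A (B.T₂ (a ⊗ₜ b)) := by
  have h := LinearMap.congr_fun B.coassoc (a ⊗ₜ b ⊗ₜ c)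
  simp only [comp_apply, leg23_tmul, leg12_tmul] at h
  have h1 : ∀ z : A ⊗[k] A, (evalSnd A B.ε).rTensor A
      (leg12 A B.T₂ ((TensorProduct.assoc k A A A).symm (a ⊗ₜ z))) = (mulLeft k a).rTensor A z := by
    intro z
    induction z with
    | zero => simp
    | add x y hx hy => simp only [map_add, TensorProduct.tmul_add, hx, hy]
    | tmul s t =>
      rw [TensorProduct.assoc_symm_tmul, leg12_tmul, rTensor_tmul, evalSnd_T₂]; rfl
  rw [← h1, h, evalSnd_leg23_T₁]

/-- A further factor 1 ⊗ d on the right reduces the identity to `T₁_T₂` and regularity. This and the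
next two lemmas identify all four maps as pieces of one multiplier Δ(b). -/
lemma T₂_T₃ (a b c : A) : (mulLeft k c).lTensor A (B.T₂ (a ⊗ₜ b)) =
    (mulLeft k a).rTensor A (B.T₃ (b ⊗ₜ c)) :=
  B.ext_mulRight_lTensor fun d => by
    rw [lTensor_mulRight_mulLeft, ← T₁_T₂, ← rTensor_lTensor_comm, ← rTensor_lTensor_comm,
      B.regular₃]

lemma T₃_T₄ (a b c : A) : (mulRight k a).rTensor A (B.T₃ (b ⊗ₜ c)) =
    (mulLeft k c).lTensor A (B.T₄ (a ⊗ₜ b)) :=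
  B.ext_mulLeft_rTensor fun d => by
    rw [← rTensor_mulRight_mulLeft, ← T₂_T₃, rTensor_lTensor_comm, rTensor_lTensor_comm,
      B.regular₄]

lemma T₁_T₄ (a b c : A) : (mulRight k b).rTensor A (B.T₁ (a ⊗ₜ c)) =
    (mulRight k c).lTensor A (B.T₄ (b ⊗ₜ a)) :=
  B.ext_mulLeft_rTensor fun d => by
    rw [← rTensor_mulRight_mulLeft, T₁_T₂, rTensor_lTensor_comm, rTensor_lTensor_comm,
      B.regular₄]

lemma evalFst_T₃ (a b : A) : evalFst A B.ε (B.T₃ (a ⊗ₜ b)) = b * a :=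
  B.ext_mulRight fun d => by
    have := congrArg (evalFst A B.ε) (B.regular₃ b d a)
    rw [evalFst_lTensor, evalFst_lTensor, evalFst_T₁] at this
    exact this.symm.trans (mul_assoc b a d).symm

lemma evalSnd_leg23_T₃ {X : Type*} [AddCommGroup X] [Module k X] (z : X ⊗[k] A) (c : A) :
    (evalSnd X B.ε).rTensor A (leg23 X B.T₃ (z ⊗ₜ c)) = (mulLeft k c).lTensor X z :=
  evalSnd_leg23 (fun a => B.evalFst_T₃ a c) z

lemma evalSnd_T₄ (a b : A) : evalSnd A B.ε (B.T₄ (a ⊗ₜ b)) = b * a :=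
  B.ext_mulLeft fun d => by
    have := congrArg (evalSnd A B.ε) (B.regular₄ d a b)
    rw [evalSnd_rTensor, evalSnd_rTensor, evalSnd_T₂] at this
    exact this.symm.trans (mul_assoc d b a)

/-- Multiplied by p on the left of the first leg and by d on the right of the third, both sides
become the given coassociativity for T₁ and T₂ at p ⊗ b ⊗ d, with a and c multiplied in from the
opposite sides. -/
lemma coassoc_op : leg12 A B.T₄ ∘ₗ leg23 A B.T₃ = leg23 A B.T₃ ∘ₗ leg12 A B.T₄ := by
  ext a b c
  simp only [TensorProduct.AlgebraTensorModule.curry_apply, TensorProduct.curry_apply,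
    coe_restrictScalars, comp_apply, leg23_tmul, leg12_tmul]
  refine B.ext_mulRight_lTensor fun d => eq_of_rTensor (fun p => (mulLeft k p).rTensor A)
    (fun y hy => eq_zero_of_rTensor _ B.nondeg_right _ hy) fun p => ?_
  have h1 : ∀ z, ((mulLeft k p).rTensor A).rTensor A ((mulRight k d).lTensor (A ⊗[k] A)
      (leg12 A B.T₄ ((TensorProduct.assoc k A A A).symm (a ⊗ₜ z)))) =
      ((mulRight k a).rTensor A).rTensor A (leg12 A B.T₂ ((TensorProduct.assoc k A A A).symm
        (p ⊗ₜ (mulRight k d).lTensor A z))) := by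
    intro z
    induction z with
    | zero => simp
    | add x y hx hy => simp only [map_add, TensorProduct.tmul_add, hx, hy]
    | tmul s t => simp [leg12_tmul, B.regular₄]
  have h2 : ∀ z, ((mulLeft k p).rTensor A).rTensor A ((mulRight k d).lTensor (A ⊗[k] A)
      (leg23 A B.T₃ (z ⊗ₜ c))) = (mulLeft k c).lTensor (A ⊗[k] A) (leg23 A B.T₁
        ((mulLeft k p).rTensor A z ⊗ₜ d)) := by
    intro z
    induction z with
    | zero => simp
    | add x y hx hy => simp only [map_add, TensorProduct.add_tmul, hx, hy]
    | tmul s t =>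
      have e : ∀ (f : A →ₗ[k] A) (s : A) (w : A ⊗[k] A), f.lTensor (A ⊗[k] A)
          ((TensorProduct.assoc k A A A).symm (s ⊗ₜ w)) =
          (TensorProduct.assoc k A A A).symm (s ⊗ₜ f.lTensor A w) := by
        intro f s w
        induction w with
        | zero => simp
        | add x y hx hy => simp only [map_add, TensorProduct.tmul_add, hx, hy]
        | tmul u v => simp
      have e' : ∀ (w : A ⊗[k] A), ((mulLeft k p).rTensor A).rTensor A
          ((TensorProduct.assoc k A A A).symm (s ⊗ₜ w)) =
          (TensorProduct.assoc k A A A).symm ((p * s) ⊗ₜ w) := by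
        intro w
        induction w with
        | zero => simp
        | add x y hx hy => simp only [map_add, TensorProduct.tmul_add, hx, hy]
        | tmul u v => simp
      rw [leg23_tmul, e, ← B.regular₃, e', rTensor_tmul, mulLeft_apply, leg23_tmul, e]
  have h3 : ∀ z, leg12 A B.T₂ ((TensorProduct.assoc k A A A).symm
        (p ⊗ₜ (mulLeft k c).lTensor A z)) = (mulLeft k c).lTensor (A ⊗[k] A)
      (leg12 A B.T₂ ((TensorProduct.assoc k A A A).symm (p ⊗ₜ z))) := by
    intro z
    induction z with
    | zero => simp
    | add x y hx hy => simp only [map_add, TensorProduct.tmul_add, hx, hy]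
    | tmul s t => simp [leg12_tmul]
  have h4 : ∀ z, leg23 A B.T₁ ((mulRight k a).rTensor A z ⊗ₜ d) =
      ((mulRight k a).rTensor A).rTensor A (leg23 A B.T₁ (z ⊗ₜ d)) := by
    intro z
    induction z with
    | zero => simp
    | add x y hx hy => simp only [map_add, TensorProduct.add_tmul, hx, hy]
    | tmul s t =>
      have e' : ∀ (w : A ⊗[k] A), ((mulRight k a).rTensor A).rTensor A
          ((TensorProduct.assoc k A A A).symm (s ⊗ₜ w)) =
          (TensorProduct.assoc k A A A).symm ((s * a) ⊗ₜ w) := by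
        intro w
        induction w with
        | zero => simp
        | add x y hx hy => simp only [map_add, TensorProduct.tmul_add, hx, hy]
        | tmul u v => simp
      rw [leg23_tmul, e', rTensor_tmul, leg23_tmul, mulRight_apply]
  have h := LinearMap.congr_fun B.coassoc (p ⊗ₜ b ⊗ₜ d)
  simp only [comp_apply, leg23_tmul, leg12_tmul] at h
  rw [h1, h2, ← B.regular₃, h3, h, ← B.regular₄, h4, rTensor_lTensor_comm]

lemma span_E₁_mem (b c : A) : B.E₁ (b ⊗ₜ c) ∈ Submodule.span k
    {x | ∃ a b c : A, x = (mulRight k b).rTensor A (B.T₁ (a ⊗ₜ c))} := by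
  rw [B.span_left]; exact Submodule.subset_span ⟨b, c, rfl⟩

lemma span_E₂_mem (b c : A) : B.E₂ (b ⊗ₜ c) ∈ Submodule.span k
    {x | ∃ a b c : A, x = (mulLeft k b).rTensor A (B.T₃ (a ⊗ₜ c))} := by
  have h : B.E₂ (b ⊗ₜ c) ∈ Submodule.span k {x | ∃ b c : A, x = B.E₂ (b ⊗ₜ c)} :=
    Submodule.subset_span ⟨b, c, rfl⟩
  rw [← B.span_right] at h
  refine Submodule.span_mono ?_ h
  rintro _ ⟨a, b, c, rfl⟩
  exact ⟨a, b, c, B.T₂_T₃ _ _ _⟩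

/-- The spanning axiom puts T₁(a ⊗ c)(b ⊗ 1) in the range of E for every b, and the factor b cancels
by non-degeneracy. -/
lemma E₁_T₁ (x : A ⊗[k] A) : B.E₁ (B.T₁ x) = B.T₁ x := by
  induction x with
  | zero => simp
  | add x y hx hy => simp only [map_add, hx, hy]
  | tmul a c =>
    refine B.idem.E₁_eq_self fun b => ?_
    have := B.span_left.le (Submodule.subset_span ⟨a, b, c, rfl⟩)
    exact this

lemma E₂_T₃ (x : A ⊗[k] A) : B.E₂ (B.T₃ x) = B.T₃ x := by
  induction x with
  | zero => simp
  | add x y hx hy => simp only [map_add, hx, hy]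
  | tmul a c =>
    refine B.idem.op.E₁_eq_self fun b => ?_
    have := B.span_right.le (Submodule.subset_span ⟨a, b, c, rfl⟩)
    rw [T₂_T₃] at this
    exact this

/-- The system of `B`. -/
def deltaSystem : DeltaSystem k A where
  toIdemSystem := B.idem
  T₁ := B.T₁
  T₂ := B.T₂
  ε := B.ε
  T_mult := B.T₁_T₂
  T₂_left a b c := B.T₂_left b c a
  coassoc := B.coassoc
  counit := B.evalSnd_T₂
  T₁_mul a b c := by
    have h := LinearMap.congr_fun B.comul_mul (a ⊗ₜ b ⊗ₜ c)
    simp only [comp_apply, leg23_tmul, rTensor_tmul] at h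
    refine h.symm.trans ?_
    generalize B.T₁ (b ⊗ₜ c) = z
    induction z with
    | zero => simp
    | add x y hx hy => simp only [map_add, TensorProduct.tmul_add, hx, hy]
    | tmul s t =>
      rw [TensorProduct.assoc_symm_tmul, leg13_tmul]
      simp only [TensorProduct.lift.tmul, compl₂_apply, comp_apply, TensorProduct.mk_apply]
      generalize B.T₁ (a ⊗ₜ t) = w
      induction w with
      | zero => simp
      | add x y hx hy => simp only [map_add, TensorProduct.add_tmul, hx, hy]
      | tmul u v => simp [idem]
  span := B.span_E₁_mem
  E₁_T₁ := B.E₁_T₁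
  E₂_T₂ x := by
    induction x with
    | zero => simp
    | add x y hx hy => simp only [map_add, hx, hy]
    | tmul p a =>
      exact B.idem.E₂_eq_self fun c =>
        B.span_right.le (Submodule.subset_span ⟨a, p, c, rfl⟩)
  counit_E₂ a b c := B.counit_E₂ a b c

lemma comulL_T₃ (b c : A) (x : A ⊗[k] A) : B.idem.mm (B.T₃ (b ⊗ₜ c)) x =
    (mulLeft k c).lTensor A (B.deltaSystem.comulL b x) := by
  induction x with
  | zero => simp
  | add x y hx hy => simp only [map_add, hx, hy]
  | tmul s t =>
    rw [IdemSystem.mm_right, DeltaSystem.comulL_tmul, IdemSystem.map_eq]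
    exact (congrArg _ (B.regular₃ c t b).symm).trans (rTensor_lTensor_comm _ _ _)

lemma lift_mul_T₃ (a d : A) (z : A ⊗[k] A) : (mulRight k d).lTensor A (TensorProduct.lift
    ((rTensorHom A ∘ₗ LinearMap.mul k A).compl₂ (B.T₃ ∘ₗ TensorProduct.mk k A A a)) z) =
      B.idem.mm z (B.T₁ (a ⊗ₜ d)) := by
  induction z with
  | zero => simp
  | add x y hx hy => simp only [map_add, LinearMap.add_apply, hx, hy]
  | tmul s t =>
    rw [IdemSystem.mm_left, IdemSystem.map_eq]
    refine Eq.trans ?_ (congrArg _ (B.regular₃ t d a).symm)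
    exact (rTensor_lTensor_comm (mulLeft k s) (mulRight k d) (B.T₃ (a ⊗ₜ t))).symm

/-- A factor 1 ⊗ d on the right converts the inner T₃ into T₁, so multiplicativity of Δ is inherited
from the T₁ form. -/
lemma T₃_mul (a b c : A) : B.T₃ ((b * a) ⊗ₜ c) = TensorProduct.lift
    ((rTensorHom A ∘ₗ LinearMap.mul k A).compl₂ (B.T₃ ∘ₗ TensorProduct.mk k A A a))
      (B.T₃ (b ⊗ₜ c)) :=
  B.ext_mulRight_lTensor fun d => by
    rw [lift_mul_T₃, comulL_T₃, ← B.regular₃]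
    exact congrArg _ (B.deltaSystem.T₁_mul' b a d)

/-- The system of the opposite of `B`. -/
def deltaSystemOp : DeltaSystem k A where
  toIdemSystem := B.idem.op
  T₁ := B.T₃
  T₂ := B.T₄
  ε := B.ε
  T_mult a b c := B.T₃_T₄ a b c
  T₂_left a b c := B.T₄_right b c a
  coassoc := B.coassoc_op
  counit := B.evalSnd_T₄
  T₁_mul a b c := B.T₃_mul a b c
  span := B.span_E₂_mem
  E₁_T₁ := B.E₂_T₃
  E₂_T₂ x := by
    induction x with
    | zero => simp
    | add x y hx hy => simp only [map_add, hx, hy]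
    | tmul b a =>
      refine B.idem.op.E₂_eq_self fun c => ?_
      have := B.span_left.le (Submodule.subset_span ⟨a, b, c, rfl⟩)
      rw [T₁_T₄] at this
      exact this
  counit_E₂ a b c := by
    have := B.counit_E₁ c a b
    rw [T₁_T₄] at this
    exact this

/-- `(b ⊓̄ᴿ(a)) c = b (⊓̄ᴿ(a) c)`. -/
lemma mul_evalSnd_E₁ (a b c : A) : b * evalSnd A B.ε (B.E₁ (c ⊗ₜ a)) =
    evalSnd A B.ε (B.T₁ (b ⊗ₜ a)) * c := by
  have h := B.deltaSystem.m_ev_E₁ b (c ⊗ₜ a)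
  rw [DeltaSystem.comulL_tmul, DeltaSystem.ev_flip_rTensor] at h
  exact h

/-- `(b ⊓ᴿ(a)) c = b (⊓ᴿ(a) c)`. -/
lemma evalSnd_E₂_mul (a b c : A) : evalSnd A B.ε (B.E₂ (b ⊗ₜ a)) * c =
    b * evalSnd A B.ε (B.T₃ (c ⊗ₜ a)) := by
  have h := B.deltaSystemOp.m_ev_E₁ c (b ⊗ₜ a)
  rw [DeltaSystem.comulL_tmul, DeltaSystem.ev_flip_rTensor] at h
  exact h

end RegularWeakMultiplierBialgebra
end WeakMultiplier

/-! ### Iterated coactions, the action of R, and comodules over the opposite system. -/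

namespace WeakMultiplier

open LinearMap

section

variable {k A V : Type*} [Field k] [AddCommGroup A] [Module k A] [AddCommGroup V] [Module k V]

/-- `(λ ⊗ A) λ¹³` on `V ⊗ (A ⊗ A)`, for a fixed vector of `V`. -/
def twice (f : V ⊗[k] A →ₗ[k] V ⊗[k] A) (v : V) : A ⊗[k] A →ₗ[k] V ⊗[k] (A ⊗[k] A) :=
  (TensorProduct.assoc k V A A).toLinearMap ∘ₗ leg12 A f ∘ₗ leg13 A f ∘ₗ
    (TensorProduct.assoc k V A A).symm.toLinearMap ∘ₗ TensorProduct.mk k V (A ⊗[k] A) v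

lemma twice_tmul (f : V ⊗[k] A →ₗ[k] V ⊗[k] A) (v : V) (b a : A) :
    twice f v (b ⊗ₜ a) = TensorProduct.assoc k V A A
      (leg12 A f (TensorProduct.rightComm k V A A (f (v ⊗ₜ a) ⊗ₜ b))) := rfl

lemma leg12_rightComm_rTensor {f : V ⊗[k] A →ₗ[k] V ⊗[k] A} (g : A →ₗ[k] A)
    (hf : ∀ v a, f (v ⊗ₜ g a) = g.lTensor V (f (v ⊗ₜ a))) (t : V ⊗[k] A) (b : A) :
    TensorProduct.assoc k V A A (leg12 A f (TensorProduct.rightComm k V A A (t ⊗ₜ g b))) =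
      (g.rTensor A).lTensor V
        (TensorProduct.assoc k V A A (leg12 A f (TensorProduct.rightComm k V A A (t ⊗ₜ b)))) := by
  induction t with
  | zero => simp
  | add x y hx hy => simp only [map_add, TensorProduct.add_tmul, hx, hy]
  | tmul v a =>
    rw [TensorProduct.rightComm_tmul, TensorProduct.rightComm_tmul, leg12_tmul, leg12_tmul, hf]
    generalize f (v ⊗ₜ b) = w
    induction w with
    | zero => simp
    | add x y hx hy => simp only [map_add, TensorProduct.add_tmul, hx, hy]
    | tmul u v => simp

/-- `(λ ⊗ A) λ¹³` commutes with maps on the second leg that commute with `λ`. -/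
lemma twice_rTensor {f : V ⊗[k] A →ₗ[k] V ⊗[k] A} (g : A →ₗ[k] A)
    (hf : ∀ v a, f (v ⊗ₜ g a) = g.lTensor V (f (v ⊗ₜ a))) (v : V) (z : A ⊗[k] A) :
    twice f v (g.rTensor A z) = (g.rTensor A).lTensor V (twice f v z) := by
  induction z with
  | zero => simp
  | add x y hx hy => simp only [map_add, hx, hy]
  | tmul b a => rw [rTensor_tmul, twice_tmul, leg12_rightComm_rTensor g hf, twice_tmul]

lemma lTensor_twice_of_norm {f : V ⊗[k] A →ₗ[k] V ⊗[k] A} {E : A ⊗[k] A →ₗ[k] A ⊗[k] A}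
    (h : leg12 A f ∘ₗ leg13 A f ∘ₗ leg23 V E = leg12 A f ∘ₗ leg13 A f) (v : V) (z : A ⊗[k] A) :
    twice f v (E z) = twice f v z := by
  have := LinearMap.congr_fun h ((TensorProduct.assoc k V A A).symm (v ⊗ₜ z))
  simp only [comp_apply, leg23_assoc_symm] at this
  exact congrArg (TensorProduct.assoc k V A A) this

lemma norm_of_twice {f : V ⊗[k] A →ₗ[k] V ⊗[k] A} {E : A ⊗[k] A →ₗ[k] A ⊗[k] A}
    (h : ∀ v z, twice f v (E z) = twice f v z) :
    leg12 A f ∘ₗ leg13 A f ∘ₗ leg23 V E = leg12 A f ∘ₗ leg13 A f := by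
  ext v a b
  exact (TensorProduct.assoc k V A A).injective (h v (a ⊗ₜ b))

lemma twice_of_coassoc {f : V ⊗[k] A →ₗ[k] V ⊗[k] A} {T : A ⊗[k] A →ₗ[k] A ⊗[k] A}
    (h : leg12 A f ∘ₗ leg13 A f ∘ₗ leg23 V T = leg23 V T ∘ₗ leg12 A f) (v : V) (a b : A) :
    twice f v (T (a ⊗ₜ b)) = T.lTensor V (TensorProduct.assoc k V A A (f (v ⊗ₜ a) ⊗ₜ b)) := by
  have := LinearMap.congr_fun h (v ⊗ₜ a ⊗ₜ b)
  simp only [comp_apply, leg23_tmul, leg12_tmul] at this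
  refine (congrArg (TensorProduct.assoc k V A A) this).trans ?_
  simp [leg23]

lemma coassoc_of_twice {f : V ⊗[k] A →ₗ[k] V ⊗[k] A} {T : A ⊗[k] A →ₗ[k] A ⊗[k] A}
    (h : ∀ v a b, twice f v (T (a ⊗ₜ b)) =
      T.lTensor V (TensorProduct.assoc k V A A (f (v ⊗ₜ a) ⊗ₜ b))) :
    leg12 A f ∘ₗ leg13 A f ∘ₗ leg23 V T = leg23 V T ∘ₗ leg12 A f := by
  ext v a b
  refine (TensorProduct.assoc k V A A).injective ((h v a b).trans ?_)
  simp [leg23, leg12]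

lemma lTensor_assoc_tmul {Y : Type*} [AddCommGroup Y] [Module k Y] (f : A ⊗[k] A →ₗ[k] Y)
    (t : V ⊗[k] A) (b : A) : f.lTensor V (TensorProduct.assoc k V A A (t ⊗ₜ b)) =
      (f ∘ₗ (TensorProduct.mk k A A).flip b).lTensor V t := by
  induction t with
  | zero => simp
  | add x y hx hy => simp only [map_add, TensorProduct.add_tmul, hx, hy]
  | tmul v a => simp

/-- `(V ⊗ A ⊗ ω) (λ ⊗ A) λ¹³`. -/
lemma evalSnd_twice (f : V ⊗[k] A →ₗ[k] V ⊗[k] A) (ω : A →ₗ[k] k) (v : V) (a b : A) :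
    f (evalSnd V ω (f (v ⊗ₜ a)) ⊗ₜ b) = (evalSnd A ω).lTensor V (twice f v (b ⊗ₜ a)) := by
  rw [twice_tmul]
  generalize f (v ⊗ₜ a) = t
  induction t with
  | zero => simp
  | add x y hx hy => simp only [map_add, TensorProduct.add_tmul, hx, hy]
  | tmul v a =>
    rw [TensorProduct.rightComm_tmul, leg12_tmul, evalSnd_tmul, ← TensorProduct.smul_tmul',
      map_smul]
    generalize f (v ⊗ₜ b) = w
    induction w with
    | zero => simp
    | add x y hx hy => simp only [map_add, smul_add, TensorProduct.add_tmul, hx, hy]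
    | tmul u v => simp

/-- A comodule over a `DeltaSystem`. -/
structure DeltaComodule (H : DeltaSystem k A) (V : Type*) [AddCommGroup V] [Module k V] where
  lam : V ⊗[k] A →ₗ[k] V ⊗[k] A
  rho : V ⊗[k] A →ₗ[k] V ⊗[k] A
  comp : ∀ (v : V) (a b : A),
    (H.m a).lTensor V (lam (v ⊗ₜ b)) = (H.m.flip b).lTensor V (rho (v ⊗ₜ a))
  norm : leg12 A lam ∘ₗ leg13 A lam ∘ₗ leg23 V H.E₁ = leg12 A lam ∘ₗ leg13 A lam
  coassoc : leg12 A lam ∘ₗ leg13 A lam ∘ₗ leg23 V H.T₁ = leg23 V H.T₁ ∘ₗ leg12 A lam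

namespace DeltaComodule

variable {H : DeltaSystem k A} (C : DeltaComodule H V)

/-- After multiplication by 1 ⊗ a, λ may be exchanged for ϱ(v ⊗ a), and then the second argument
only acts by right multiplication. -/
lemma lam_right (v : V) (b c : A) :
    C.lam (v ⊗ₜ H.m b c) = (H.m.flip c).lTensor V (C.lam (v ⊗ₜ b)) :=
  eq_of_lTensor H.m (fun y hy => H.nondeg_right y hy) fun a => by
    rw [← IdemSystem.lTensor_flip_comm, C.comp, C.comp, IdemSystem.lTensor_flip_flip]

lemma twice_norm (v : V) (z : A ⊗[k] A) : twice C.lam v (H.E₁ z) = twice C.lam v z :=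
  lTensor_twice_of_norm C.norm v z

lemma twice_T₁ (v : V) (a b : A) : twice C.lam v (H.T₁ (a ⊗ₜ b)) =
    H.T₁.lTensor V (TensorProduct.assoc k V A A (C.lam (v ⊗ₜ a) ⊗ₜ b)) :=
  twice_of_coassoc C.coassoc v a b

lemma twice_right (v : V) (c : A) (z : A ⊗[k] A) : twice C.lam v ((H.m.flip c).rTensor A z) =
    ((H.m.flip c).rTensor A).lTensor V (twice C.lam v z) :=
  twice_rTensor _ (fun v a => C.lam_right v a c) v z

/-- Linear identities for `(λ ⊗ A) λ¹³` can be checked on the elements `Δ(a) (1 ⊗ b)` if they are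
compatible with the right multiplication in the second leg. -/
lemma twice_ext {Y : Type*} [AddCommGroup Y] [Module k Y] {v : V}
    {f : V ⊗[k] (A ⊗[k] A) →ₗ[k] Y} {g : A ⊗[k] A →ₗ[k] Y} (r : A → Y →ₗ[k] Y)
    (hf : ∀ c t, f (((H.m.flip c).rTensor A).lTensor V t) = r c (f t))
    (hg : ∀ c t, g ((H.m.flip c).rTensor A t) = r c (g t))
    (h : ∀ a b, f (twice C.lam v (H.T₁ (a ⊗ₜ b))) = g (H.T₁ (a ⊗ₜ b))) (z : A ⊗[k] A) :
    f (twice C.lam v z) = g (H.E₁ z) := by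
  -- Normalisation replaces z by Ez, which lies in the span of the elements T₁(x ⊗ y)(s ⊗ 1).
  rw [← C.twice_norm]
  have h1 : ∀ w ∈ Submodule.span k {x | ∃ a b c : A, x = (H.m.flip b).rTensor A (H.T₁ (a ⊗ₜ c))},
      f (twice C.lam v w) = g w := by
    intro w hw
    induction hw using Submodule.span_induction with
    | zero => simp
    | add x y _ _ hx hy => simp only [map_add, hx, hy]
    | smul c x _ hx => simp only [map_smul, hx]
    | mem w hw =>
      obtain ⟨x, s, y, rfl⟩ := hw
      rw [twice_right, hf, h, hg]
  apply h1
  induction z with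
  | zero => simp
  | add x y hx hy => rw [map_add]; exact add_mem hx hy
  | tmul s t => exact H.span s t

/-- The iterated coaction absorbs E on the output side as well: on T₁(a ⊗ b), coassociativity brings
T₁ outermost, and E T₁ = T₁. -/
lemma lTensor_E₁_twice (v : V) (z : A ⊗[k] A) :
    H.E₁.lTensor V (twice C.lam v z) = twice C.lam v z := by
  refine Eq.trans ?_ (C.twice_norm v z)
  refine C.twice_ext (f := H.E₁.lTensor V) (g := twice C.lam v)
    (fun c => ((H.m.flip c).rTensor A).lTensor V) (fun c t => ?_) (C.twice_right v) ?_ z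
  · rw [← lTensor_comp_apply, ← lTensor_comp_apply]
    congr 2
    ext1; ext1 t
    exact LinearMap.ext fun s => H.E₁_rTensor c (t ⊗ₜ s)
  · intro a b
    rw [C.twice_T₁, ← lTensor_comp_apply]
    congr 2
    exact LinearMap.ext H.E₁_T₁

/-- `λ(v ⊓̄ᴿ(a) ⊗ b) = λ(v ⊗ ⊓̄ᴿ(a) b)`. -/
lemma lam_action (v : V) (a b : A) : C.lam (evalSnd V H.ε (C.lam (v ⊗ₜ a)) ⊗ₜ b) =
    C.lam (v ⊗ₜ H.ev (H.E₁ (b ⊗ₜ a))) := by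
  rw [evalSnd_twice]
  refine C.twice_ext (f := H.ev.lTensor V) (g := C.lam ∘ₗ TensorProduct.mk k V A v ∘ₗ H.ev)
    (fun c => (H.m.flip c).lTensor V) (fun c t => ?_) (fun c t => ?_) (fun x y => ?_) (b ⊗ₜ a)
  · rw [← lTensor_comp_apply, ← lTensor_comp_apply]
    congr 2
    exact LinearMap.ext fun t => H.ev_flip_rTensor c t
  · simp only [comp_apply, TensorProduct.mk_apply, H.ev_flip_rTensor, C.lam_right]
  · rw [C.twice_T₁, ← lTensor_comp_apply, lTensor_assoc_tmul]
    -- Put φ = (A ⊗ ε)T₁(- ⊗ y), which is left A-linear. Then (1 ⊗ d)(V ⊗ φ)λ(v ⊗ x) = (V ⊗ φ)(ϱ(v ⊗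
    -- d)(1 ⊗ x)) = ϱ(v ⊗ d)(1 ⊗ φ(x)) = (1 ⊗ d)λ(v ⊗ φ(x)).
    refine eq_of_lTensor H.m (fun y hy => H.nondeg_right y hy) fun d => ?_
    have e1 : H.m d ∘ₗ (H.ev ∘ₗ H.T₁) ∘ₗ (TensorProduct.mk k A A).flip y =
        ((H.ev ∘ₗ H.T₁) ∘ₗ (TensorProduct.mk k A A).flip y) ∘ₗ H.m d :=
      LinearMap.ext fun t => (H.ev_T₁_left d t y).symm
    have e2 : ((H.ev ∘ₗ H.T₁) ∘ₗ (TensorProduct.mk k A A).flip y) ∘ₗ H.m.flip x =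
        H.m.flip (H.ev (H.T₁ (x ⊗ₜ y))) :=
      LinearMap.ext fun t => H.ev_T₁_left t x y
    rw [← lTensor_comp_apply, e1, lTensor_comp_apply, C.comp, ← lTensor_comp_apply, e2]
    exact (C.comp _ _ _).symm

end DeltaComodule

end

namespace RightComodule

variable {k A : Type*} [Field k] [NonUnitalRing A] [Module k A] [IsScalarTower k A A]
  [SMulCommClass k A A] {B : RegularWeakMultiplierBialgebra k A} {V : Type*} [AddCommGroup V]
  [Module k V] (C : RightComodule B V)

/-- A right comodule as a comodule over the system of `B`. -/
def toDelta : DeltaComodule B.deltaSystem V where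
  lam := C.lam
  rho := C.rho
  comp := C.comp
  norm := C.norm
  coassoc := C.coassoc

lemma lam_mul (v : V) (b c : A) :
    C.lam (v ⊗ₜ (b * c)) = (mulRight k c).lTensor V (C.lam (v ⊗ₜ b)) :=
  C.toDelta.lam_right v b c

/-- `(λ ⊗ A) λ¹³` and `(ϱ ⊗ A) ϱ¹³` belong to the same multiplier. -/
lemma twice_comp (v : V) (x y : A ⊗[k] A) : (B.idem.mm x).lTensor V (twice C.lam v y) =
    (B.idem.mm.flip y).lTensor V (twice C.rho v x) := by
  have e : ∀ (f g : A →ₗ[k] A) (w : V ⊗[k] A) (r : A), (TensorProduct.map f g).lTensor V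
      (TensorProduct.assoc k V A A (w ⊗ₜ r)) =
      TensorProduct.assoc k V A A (f.lTensor V w ⊗ₜ g r) := by
    intro f g w r
    induction w with
    | zero => simp
    | add x y hx hy => simp only [map_add, TensorProduct.add_tmul, hx, hy]
    | tmul v d => simp
  have h1 : ∀ (a b c : A) (t : V ⊗[k] A),
      (TensorProduct.map (mulLeft k a) (mulLeft k c)).lTensor V (TensorProduct.assoc k V A A
        (leg12 A C.lam (TensorProduct.rightComm k V A A (t ⊗ₜ b)))) =
      (TensorProduct.map (mulRight k b) LinearMap.id).lTensor V (TensorProduct.assoc k V A A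
        (leg12 A C.rho (TensorProduct.rightComm k V A A ((mulLeft k c).lTensor V t ⊗ₜ a)))) := by
    intro a b c t
    induction t with
    | zero => simp
    | add x y hx hy => simp only [map_add, TensorProduct.add_tmul, hx, hy]
    | tmul v d =>
      rw [lTensor_tmul, TensorProduct.rightComm_tmul, TensorProduct.rightComm_tmul, leg12_tmul,
        leg12_tmul, e, e, C.comp]
      rfl
  have h2 : ∀ (a b d : A) (t : V ⊗[k] A),
      (TensorProduct.map (mulRight k b) (mulRight k d)).lTensor V (TensorProduct.assoc k V A A
        (leg12 A C.rho (TensorProduct.rightComm k V A A (t ⊗ₜ a)))) =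
      (TensorProduct.map (mulRight k b) LinearMap.id).lTensor V (TensorProduct.assoc k V A A
        (leg12 A C.rho (TensorProduct.rightComm k V A A ((mulRight k d).lTensor V t ⊗ₜ a)))) := by
    intro a b d t
    induction t with
    | zero => simp
    | add x y hx hy => simp only [map_add, TensorProduct.add_tmul, hx, hy]
    | tmul v c =>
      rw [lTensor_tmul, TensorProduct.rightComm_tmul, TensorProduct.rightComm_tmul, leg12_tmul,
        leg12_tmul, e, e]
      rfl
  induction x with
  | zero => simp
  | add x y hx hy => simp only [map_add, lTensor_add, LinearMap.add_apply, hx, hy]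
  | tmul a c =>
  induction y with
  | zero => simp
  | add x y hx hy => simp only [map_add, lTensor_add, LinearMap.add_apply, hx, hy]
  | tmul b d =>
    have e1 : B.idem.mm (a ⊗ₜ c) = TensorProduct.map (mulLeft k a) (mulLeft k c) :=
      LinearMap.ext fun z => B.idem.mm_left a c z
    have e2 : B.idem.mm.flip (b ⊗ₜ d) = TensorProduct.map (mulRight k b) (mulRight k d) :=
      LinearMap.ext fun z => B.idem.mm_right b d z
    -- `h1` exchanges the outer λ for ϱ and leaves c on the inner λ, which `C.comp` then exchanges.
    rw [e1, e2, twice_tmul, twice_tmul, h1, h2, C.comp]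

/-- Tested against y, the iterated ϱ passes to the iterated λ of y, on which zE acts as z because
the output of λ absorbs E. -/
lemma twice_rho_E₂ (v : V) (z : A ⊗[k] A) : twice C.rho v (B.E₂ z) = twice C.rho v z := by
  refine eq_of_lTensor B.idem.mm.flip B.idem.mm_nondeg_left fun y => ?_
  have e : B.idem.mm (B.E₂ z) = B.idem.mm z ∘ₗ B.E₁ :=
    LinearMap.ext fun x => (B.idem.E_mm z x).symm
  have h := C.toDelta.lTensor_E₁_twice v y
  refine (C.twice_comp v _ y).symm.trans (Eq.trans ?_ (C.twice_comp v _ y))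
  rw [e, lTensor_comp_apply]
  exact congrArg _ h

/-- Tested against y and passed to λ, the claim need only be checked for y = T₁(x ⊗ w). With ψ = (1
⊗ b)T₁(- ⊗ w), the two sides are V ⊗ ψ applied to (1 ⊗ a)λ(v ⊗ x) and to ϱ(v ⊗ a)(1 ⊗ x). -/
lemma twice_rho_T₃ (v : V) (a b : A) : twice C.rho v (B.T₃ (a ⊗ₜ b)) =
    B.T₃.lTensor V (TensorProduct.assoc k V A A (C.rho (v ⊗ₜ a) ⊗ₜ b)) := by
  refine eq_of_lTensor B.idem.mm.flip B.idem.mm_nondeg_left fun y => ?_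
  refine (C.twice_comp v _ y).symm.trans ?_
  -- `twice_ext` produces Ey on the right side; the extra E is harmless since T₃(z)E = T₃(z).
  have e : ∀ y, (B.idem.mm.flip y).lTensor V (B.T₃.lTensor V
      (TensorProduct.assoc k V A A (C.rho (v ⊗ₜ a) ⊗ₜ b))) =
      (B.idem.mm.flip (B.E₁ y)).lTensor V (B.T₃.lTensor V
      (TensorProduct.assoc k V A A (C.rho (v ⊗ₜ a) ⊗ₜ b))) := by
    intro y
    rw [← lTensor_comp_apply, ← lTensor_comp_apply]
    congr 2
    refine LinearMap.ext fun z => ?_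
    refine Eq.trans ?_ (B.idem.E_mm (B.T₃ z) y).symm
    exact congrArg (fun w => B.idem.mm w y) (B.E₂_T₃ z).symm
  refine Eq.trans ?_ (e y).symm
  refine C.toDelta.twice_ext (f := (B.idem.mm (B.T₃ (a ⊗ₜ b))).lTensor V)
    (g := ((lTensorHom V ∘ₗ B.idem.mm.flip).flip (B.T₃.lTensor V
      (TensorProduct.assoc k V A A (C.rho (v ⊗ₜ a) ⊗ₜ b)))))
    (fun c => ((mulRight k c).rTensor A).lTensor V) (fun c t => ?_) (fun c t => ?_)
    (fun x w => ?_) y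
  · rw [← lTensor_comp_apply, ← lTensor_comp_apply]
    congr 2
    exact LinearMap.ext fun z => B.idem.mm_rTensor c z _
  · simp only [LinearMap.flip_apply, comp_apply, coe_lTensorHom]
    have e : B.idem.mm.flip ((mulRight k c).rTensor A t) =
        (mulRight k c).rTensor A ∘ₗ B.idem.mm.flip t :=
      LinearMap.ext fun z => B.idem.mm_rTensor c t z
    exact (LinearMap.congr_fun (congrArg (LinearMap.lTensor V) e) _).trans
      (lTensor_comp_apply _ _ _ _)
  · rw [C.toDelta.twice_T₁]
    simp only [LinearMap.flip_apply, comp_apply, coe_lTensorHom]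
    rw [← lTensor_comp_apply, ← lTensor_comp_apply, lTensor_assoc_tmul, lTensor_assoc_tmul]
    have e1 : (B.idem.mm (B.T₃ (a ⊗ₜ b)) ∘ₗ B.T₁) ∘ₗ (TensorProduct.mk k A A).flip w =
        ((mulLeft k b).lTensor A ∘ₗ B.T₁ ∘ₗ (TensorProduct.mk k A A).flip w) ∘ₗ mulLeft k a :=
      LinearMap.ext fun l => (B.comulL_T₃ a b _).trans
        (congrArg _ (B.deltaSystem.T₁_mul' a l w).symm)
    have e2 : (B.idem.mm.flip (B.T₁ (x ⊗ₜ w)) ∘ₗ B.T₃) ∘ₗ (TensorProduct.mk k A A).flip b =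
        ((mulLeft k b).lTensor A ∘ₗ B.T₁ ∘ₗ (TensorProduct.mk k A A).flip w) ∘ₗ mulRight k x :=
      LinearMap.ext fun n => (B.comulL_T₃ n b _).trans
        (congrArg _ (B.deltaSystem.T₁_mul' n x w).symm)
    have h := C.comp v a x
    refine (LinearMap.congr_fun (congrArg (LinearMap.lTensor V) e1) _).trans
      (Eq.trans ?_ (LinearMap.congr_fun (congrArg (LinearMap.lTensor V) e2) _).symm)
    exact (lTensor_comp_apply _ _ _ _).trans
      ((congrArg _ h).trans (lTensor_comp_apply _ _ _ _).symm)

/-- A right comodule as a comodule over the opposite system of `B`. -/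
def toDeltaOp : DeltaComodule B.deltaSystemOp V where
  lam := C.rho
  rho := C.lam
  comp v a b := (C.comp v b a).symm
  norm := norm_of_twice C.twice_rho_E₂
  coassoc := coassoc_of_twice C.twice_rho_T₃

end RightComodule

end WeakMultiplier

/-! ### Transport of a comodule structure along a surjection. -/

namespace WeakMultiplier

open LinearMap

section Quotient

variable {k A : Type*} [Field k] [AddCommGroup A] [Module k A] {X : Type*} [AddCommGroup X]
  [Module k X] {Y : Type*} [AddCommGroup Y] [Module k Y]

/-- A map on `X ⊗ A` that is compatible with a surjection `p : X → Y` induces a map on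
`Y ⊗ A`. -/
lemma exists_comp_rTensor {p : X →ₗ[k] Y} (hp : Function.Surjective p)
    (f : X ⊗[k] A →ₗ[k] X ⊗[k] A) (hf : ∀ x ∈ ker p, ∀ a, p.rTensor A (f (x ⊗ₜ a)) = 0) :
    ∃ g : Y ⊗[k] A →ₗ[k] Y ⊗[k] A, g ∘ₗ p.rTensor A = p.rTensor A ∘ₗ f := by
  -- The choice of section is immaterial: s(p(x)) and x differ by an element of the kernel.
  obtain ⟨s, hs⟩ := p.exists_rightInverse_of_surjective (range_eq_top.2 hp)
  refine ⟨p.rTensor A ∘ₗ f ∘ₗ s.rTensor A, TensorProduct.ext' fun x a => ?_⟩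
  have hx : s (p x) - x ∈ ker p := by
    rw [mem_ker, map_sub, sub_eq_zero]
    exact LinearMap.congr_fun hs (p x)
  have := hf _ hx a
  rwa [TensorProduct.sub_tmul, map_sub, map_sub, sub_eq_zero] at this

lemma rTensor_leg12 {f : X ⊗[k] A →ₗ[k] X ⊗[k] A} {g : Y ⊗[k] A →ₗ[k] Y ⊗[k] A} {p : X →ₗ[k] Y}
    (h : g ∘ₗ p.rTensor A = p.rTensor A ∘ₗ f) (t : X ⊗[k] A ⊗[k] A) :
    leg12 A g ((p.rTensor A).rTensor A t) = (p.rTensor A).rTensor A (leg12 A f t) := by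
  simp only [leg12, ← rTensor_comp_apply, h]

lemma rTensor_leg13 {f : X ⊗[k] A →ₗ[k] X ⊗[k] A} {g : Y ⊗[k] A →ₗ[k] Y ⊗[k] A} {p : X →ₗ[k] Y}
    (h : g ∘ₗ p.rTensor A = p.rTensor A ∘ₗ f) (t : X ⊗[k] A ⊗[k] A) :
    leg13 A g ((p.rTensor A).rTensor A t) = (p.rTensor A).rTensor A (leg13 A f t) := by
  have e : ∀ t : X ⊗[k] A ⊗[k] A, TensorProduct.rightComm k Y A A ((p.rTensor A).rTensor A t) =
      (p.rTensor A).rTensor A (TensorProduct.rightComm k X A A t) := fun t => by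
    induction t with
    | zero => simp
    | add x y hx hy => simp only [map_add, hx, hy]
    | tmul t a =>
      induction t with
      | zero => simp
      | add x y hx hy => simp only [map_add, TensorProduct.add_tmul, hx, hy]
      | tmul x b => simp
  have h' := rTensor_leg12 h
  simp only [leg12] at h'
  simp only [leg13, comp_apply, LinearEquiv.coe_coe, e, h']

lemma rTensor_leg23 (T : A ⊗[k] A →ₗ[k] A ⊗[k] A) (p : X →ₗ[k] Y) (t : X ⊗[k] A ⊗[k] A) :
    leg23 Y T ((p.rTensor A).rTensor A t) = (p.rTensor A).rTensor A (leg23 X T t) := by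
  induction t with
  | zero => simp
  | add x y hx hy => simp only [map_add, hx, hy]
  | tmul t a =>
    induction t with
    | zero => simp
    | add x y hx hy => simp only [map_add, TensorProduct.add_tmul, hx, hy]
    | tmul x b =>
      rw [rTensor_tmul, rTensor_tmul, leg23_tmul, leg23_tmul]
      generalize T (b ⊗ₜ a) = w
      induction w with
      | zero => simp
      | add x y hx hy => simp only [map_add, TensorProduct.tmul_add, hx, hy]
      | tmul u v => simp

end Quotient

section QuotientComodule

variable {k A : Type*} [Field k] [NonUnitalRing A] [Module k A] [IsScalarTower k A A]
  [SMulCommClass k A A] {B : RegularWeakMultiplierBialgebra k A} {X Y : Type*} [AddCommGroup X]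
  [Module k X] [AddCommGroup Y] [Module k Y]

/-- A comodule structure transported along a surjection. -/
def RightComodule.ofSurjective (C : RightComodule B X) (p : X →ₗ[k] Y)
    (hp : Function.Surjective p) (f g : Y ⊗[k] A →ₗ[k] Y ⊗[k] A)
    (hf : f ∘ₗ p.rTensor A = p.rTensor A ∘ₗ C.lam) (hg : g ∘ₗ p.rTensor A = p.rTensor A ∘ₗ C.rho) :
    RightComodule B Y where
  lam := f
  rho := g
  comp y a b := by
    obtain ⟨x, rfl⟩ := hp y
    have h1 := LinearMap.congr_fun hf (x ⊗ₜ b)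
    have h2 := LinearMap.congr_fun hg (x ⊗ₜ a)
    simp only [comp_apply, rTensor_tmul] at h1 h2
    rw [h1, h2, ← rTensor_lTensor_comm, ← rTensor_lTensor_comm, C.comp]
  norm := by
    rw [← cancel_right (rTensor_surjective A (rTensor_surjective A hp))]
    refine LinearMap.ext fun t => ?_
    simp only [comp_apply, rTensor_leg23, rTensor_leg13 hf, rTensor_leg12 hf]
    exact congrArg _ (LinearMap.congr_fun C.norm t)
  coassoc := by
    rw [← cancel_right (rTensor_surjective A (rTensor_surjective A hp))]
    refine LinearMap.ext fun t => ?_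
    simp only [comp_apply, rTensor_leg23, rTensor_leg13 hf, rTensor_leg12 hf]
    exact congrArg _ (LinearMap.congr_fun C.coassoc t)

end QuotientComodule

/-! ### The action of R under λ and ϱ, and descent to V ⊗_R W. -/

section Action

variable {k A : Type*} [Field k] [NonUnitalRing A] [Module k A] [IsScalarTower k A A]
  [SMulCommClass k A A] {B : RegularWeakMultiplierBialgebra k A}

lemma piBarR_fst (a b : A) : (piBarR B a).1 b = evalSnd A B.ε (B.E₁ (b ⊗ₜ a)) := rfl
lemma piR_snd (a b : A) : (piR B a).2 b = evalSnd A B.ε (B.E₂ (b ⊗ₜ a)) := rfl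

/-- The pair `⊓̄ᴿ(a)` is a multiplier. -/
lemma mul_piBarR (a b c : A) : b * (piBarR B a).1 c = (piBarR B a).2 b * c :=
  B.mul_evalSnd_E₁ a b c

/-- The pair `⊓ᴿ(a)` is a multiplier. -/
lemma mul_piR (a b c : A) : b * (piR B a).1 c = (piR B a).2 b * c :=
  (B.evalSnd_E₂_mul a b c).symm

namespace RightComodule

variable {V W : Type*} [AddCommGroup V] [Module k V] [AddCommGroup W] [Module k W]
  (C : RightComodule B V) (D : RightComodule B W)

/-- `λ(v ⊓̄ᴿ(a) ⊗ b) = λ(v ⊗ ⊓̄ᴿ(a) b)`. -/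
lemma lam_right_action (v : V) (a b : A) :
    C.lam (evalSnd V B.ε (C.lam (v ⊗ₜ a)) ⊗ₜ b) = C.lam (v ⊗ₜ (piBarR B a).1 b) :=
  C.toDelta.lam_action v a b

/-- `ϱ(⊓ᴿ(a) v ⊗ b) = ϱ(v ⊗ b ⊓ᴿ(a))`. -/
lemma rho_left_action (v : V) (a b : A) :
    C.rho (evalSnd V B.ε (C.rho (v ⊗ₜ a)) ⊗ₜ b) = C.rho (v ⊗ₜ (piR B a).2 b) :=
  C.toDeltaOp.lam_action v a b

/-- `ϱ(v ⊓̄ᴿ(a) ⊗ b) = ϱ(v ⊗ b) (1 ⊗ ⊓̄ᴿ(a))`. -/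
lemma rho_right_action (v : V) (a b : A) :
    C.rho (evalSnd V B.ε (C.lam (v ⊗ₜ a)) ⊗ₜ b) =
      (piBarR B a).2.lTensor V (C.rho (v ⊗ₜ b)) :=
  B.ext_mulRight_lTensor fun c => by
    rw [← C.comp, lam_right_action, C.comp, ← lTensor_comp_apply]
    congr 2
    ext d
    exact mul_piBarR a d c

/-- `λ(⊓ᴿ(a) v ⊗ b) = (1 ⊗ ⊓ᴿ(a)) λ(v ⊗ b)`. -/
lemma lam_left_action (v : V) (a b : A) :
    C.lam (evalSnd V B.ε (C.rho (v ⊗ₜ a)) ⊗ₜ b) =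
      (piR B a).1.lTensor V (C.lam (v ⊗ₜ b)) :=
  B.ext_mulLeft_lTensor fun c => by
    rw [C.comp, rho_left_action, ← C.comp, ← lTensor_comp_apply]
    congr 2
    ext d
    exact (mul_piR a c d).symm

lemma tensor_lam_tmul (v : V) (w : W) (a : A) : (C.tensor D).lam (v ⊗ₜ w ⊗ₜ a) =
    leg13 W C.lam ((TensorProduct.assoc k V W A).symm (v ⊗ₜ D.lam (w ⊗ₜ a))) := rfl

lemma tensor_rho_tmul (v : V) (w : W) (a : A) : (C.tensor D).rho (v ⊗ₜ w ⊗ₜ a) =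
    leg23 V D.rho (TensorProduct.rightComm k V A W (C.rho (v ⊗ₜ a) ⊗ₜ w)) := rfl

/-- The coaction of `V ⊗ W` vanishes on the elements `v r ⊗ w - v ⊗ r w`. -/
lemma tensor_lam_balanced {x : V ⊗[k] W} (hx : x ∈ balanced C D) (c : A) :
    (C.tensor D).lam (x ⊗ₜ c) = 0 := by
  induction hx using Submodule.span_induction with
  | zero => simp
  | add x y _ _ hx hy => rw [TensorProduct.add_tmul, map_add, hx, hy, add_zero]
  | smul s x _ hx => rw [← TensorProduct.smul_tmul', map_smul, hx, smul_zero]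
  | mem x hx =>
    obtain ⟨r, -, v, v', w, w', ⟨a, rfl, rfl⟩, ⟨b, hab, rfl⟩, rfl⟩ := hx
    -- With r = ⊓̄ᴿ(a) = ⊓ᴿ(b), the action on v passes to the A-leg of t = λ(w ⊗ c), where
    -- multiplication by r is the coaction of rw.
    have h : ∀ t : W ⊗[k] A, leg13 W C.lam ((TensorProduct.assoc k V W A).symm
        (evalSnd V B.ε (C.lam (v ⊗ₜ a)) ⊗ₜ t)) = leg13 W C.lam
          ((TensorProduct.assoc k V W A).symm (v ⊗ₜ (piBarR B a).1.lTensor W t)) := by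
      intro t
      induction t with
      | zero => simp
      | add x y hx hy => simp only [map_add, TensorProduct.tmul_add, hx, hy]
      | tmul w d =>
        rw [lTensor_tmul, TensorProduct.assoc_symm_tmul, TensorProduct.assoc_symm_tmul,
          leg13_tmul, leg13_tmul, lam_right_action]
    rw [TensorProduct.sub_tmul, map_sub, tensor_lam_tmul, tensor_lam_tmul, h, lam_left_action,
      hab, sub_self]

lemma tensor_rho_balanced {x : V ⊗[k] W} (hx : x ∈ balanced C D) (c : A) :
    (C.tensor D).rho (x ⊗ₜ c) = 0 := by
  induction hx using Submodule.span_induction with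
  | zero => simp
  | add x y _ _ hx hy => rw [TensorProduct.add_tmul, map_add, hx, hy, add_zero]
  | smul s x _ hx => rw [← TensorProduct.smul_tmul', map_smul, hx, smul_zero]
  | mem x hx =>
    obtain ⟨r, -, v, v', w, w', ⟨a, rfl, rfl⟩, ⟨b, hab, rfl⟩, rfl⟩ := hx
    -- For ϱ the roles of V and W are reversed: the action on w becomes right multiplication by r on
    -- the A-leg of ϱ(v ⊗ c), which is the coaction of vr.
    have h : ∀ t : V ⊗[k] A, leg23 V D.rho (TensorProduct.rightComm k V A W
        (t ⊗ₜ evalSnd W B.ε (D.rho (w ⊗ₜ b)))) = leg23 V D.rho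
          (TensorProduct.rightComm k V A W ((piR B b).2.lTensor V t ⊗ₜ w)) := by
      intro t
      induction t with
      | zero => simp
      | add x y hx hy => simp only [map_add, TensorProduct.add_tmul, hx, hy]
      | tmul v d =>
        rw [lTensor_tmul, TensorProduct.rightComm_tmul, TensorProduct.rightComm_tmul,
          leg23_tmul, leg23_tmul, rho_left_action]
    rw [TensorProduct.sub_tmul, map_sub, tensor_rho_tmul, tensor_rho_tmul, h, rho_right_action,
      hab, sub_self]

lemma baseProj_surjective : Function.Surjective (baseProj C D) :=
  Submodule.mkQ_surjective _

/-- The comodule structure of `V ⊗ W` induces one on `V ⊗_R W`. -/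
lemma exists_isComoduleHom_baseProj :
    ∃ P : RightComodule B (BaseTensor C D), IsComoduleHom (C.tensor D) P (baseProj C D) := by
  have h : ∀ x ∈ ker (baseProj C D), x ∈ balanced C D := fun x hx =>
    (Submodule.Quotient.mk_eq_zero _).1 hx
  obtain ⟨f, hf⟩ := exists_comp_rTensor (baseProj_surjective C D) (C.tensor D).lam
    fun x hx a => by rw [C.tensor_lam_balanced D (h x hx), map_zero]
  obtain ⟨g, hg⟩ := exists_comp_rTensor (baseProj_surjective C D) (C.tensor D).rho
    fun x hx a => by rw [C.tensor_rho_balanced D (h x hx), map_zero]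
  exact ⟨(C.tensor D).ofSurjective _ (baseProj_surjective C D) f g hf hg, hf, hg⟩

lemma eq_of_isComoduleHom_surjective {p : V →ₗ[k] W} (hp : Function.Surjective p)
    {P Q : RightComodule B W} (hP : IsComoduleHom C P p) (hQ : IsComoduleHom C Q p) : P = Q := by
  have h := rTensor_surjective A hp
  exact RightComodule.ext ((cancel_right h).1 (hP.1.trans hQ.1.symm))
    ((cancel_right h).1 (hP.2.trans hQ.2.symm))

end RightComodule

end Action

end WeakMultiplier

/-! ### Equality of ranges from right fullness, and fullness of V ⊗_R W. -/

namespace WeakMultiplier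

open LinearMap

variable {k A : Type*} [Field k] [NonUnitalRing A] [Module k A] [IsScalarTower k A A]
  [SMulCommClass k A A] {B : RegularWeakMultiplierBialgebra k A}

namespace RegularWeakMultiplierBialgebra

variable (B)

lemma E₁_right (a b c : A) : B.E₁ (a ⊗ₜ (b * c)) = (mulRight k c).lTensor A (B.E₁ (a ⊗ₜ b)) :=
  B.ext_mulLeft_lTensor fun q => B.ext_mulLeft_rTensor fun p => by
    have h := B.E_multiplier p q a (b * c)
    have h' := B.E_multiplier p q a b
    simp only [IdemSystem.map_eq] at h h'
    rw [h, lTensor_mulRight_mul, ← lTensor_mulRight_mulLeft,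
      rTensor_lTensor_comm (mulRight k a), rTensor_lTensor_comm (mulLeft k p), h']

lemma E₂_left (a b c : A) : B.E₂ (a ⊗ₜ (c * b)) = (mulLeft k c).lTensor A (B.E₂ (a ⊗ₜ b)) :=
  B.idem.E₂_lTensor c (a ⊗ₜ b)

/-- Left multiplication by b on the middle leg turns T₃ into T₂, and so reduces the claim to the
axiom given for T₂. -/
lemma E_comul_op : leg12 A B.E₂ ∘ₗ leg23 A B.T₃ = leg23 A B.T₃ ∘ₗ leg12 A B.E₂ := by
  ext z c d
  simp only [TensorProduct.AlgebraTensorModule.curry_apply, TensorProduct.curry_apply,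
    coe_restrictScalars, comp_apply, leg23_tmul, leg12_tmul]
  refine eq_of_rTensor (fun b => (mulLeft k b).lTensor A)
    (fun y hy => B.ext_mulLeft_lTensor fun a => (hy a).trans (map_zero _).symm) fun b => ?_
  have h1 : ∀ w, ((mulLeft k b).lTensor A).rTensor A
      (leg12 A B.E₂ ((TensorProduct.assoc k A A A).symm (z ⊗ₜ w))) =
      leg12 A B.E₂ ((TensorProduct.assoc k A A A).symm (z ⊗ₜ (mulLeft k b).rTensor A w)) := by
    intro w
    induction w with
    | zero => simp
    | add x y hx hy => simp only [map_add, TensorProduct.tmul_add, hx, hy]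
    | tmul s t => simp [leg12_tmul, E₂_left]
  have h2 : ∀ w, leg12 A B.E₂ ((TensorProduct.assoc k A A A).symm
      (z ⊗ₜ (mulLeft k d).lTensor A w)) = (mulLeft k d).lTensor (A ⊗[k] A)
        (leg12 A B.E₂ ((TensorProduct.assoc k A A A).symm (z ⊗ₜ w))) := by
    intro w
    induction w with
    | zero => simp
    | add x y hx hy => simp only [map_add, TensorProduct.tmul_add, hx, hy]
    | tmul s t => simp [leg12_tmul]
  have h3 : ∀ w, (mulLeft k d).lTensor (A ⊗[k] A) (leg23 A B.T₂
      (TensorProduct.rightComm k A A A (w ⊗ₜ b))) =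
      ((mulLeft k b).lTensor A).rTensor A (leg23 A B.T₃ (w ⊗ₜ d)) := by
    intro w
    induction w with
    | zero => simp
    | add x y hx hy => simp only [map_add, TensorProduct.add_tmul, hx, hy]
    | tmul s t =>
      have e1 : ∀ u : A ⊗[k] A, (mulLeft k d).lTensor (A ⊗[k] A)
          ((TensorProduct.assoc k A A A).symm (s ⊗ₜ u)) =
          (TensorProduct.assoc k A A A).symm (s ⊗ₜ (mulLeft k d).lTensor A u) := by
        intro u
        induction u with
        | zero => simp
        | add x y hx hy => simp only [map_add, TensorProduct.tmul_add, hx, hy]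
        | tmul x y => simp
      have e2 : ∀ u : A ⊗[k] A, ((mulLeft k b).lTensor A).rTensor A
          ((TensorProduct.assoc k A A A).symm (s ⊗ₜ u)) =
          (TensorProduct.assoc k A A A).symm (s ⊗ₜ (mulLeft k b).rTensor A u) := by
        intro u
        induction u with
        | zero => simp
        | add x y hx hy => simp only [map_add, TensorProduct.tmul_add, hx, hy]
        | tmul x y => simp
      rw [TensorProduct.rightComm_tmul, leg23_tmul, leg23_tmul, e1, e2, T₂_T₃]
  have h := LinearMap.congr_fun B.E_comul' (z ⊗ₜ b ⊗ₜ c)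
  simp only [comp_apply, leg23_tmul, leg13_tmul] at h
  rw [h1, ← T₂_T₃, h2, h, h3]

/-- `(A ⊗ ω) (A ⊗ ε ⊗ A) (E ⊗ A)` on elements of `A ⊗ (A ⊗ A)`. -/
lemma evalSnd_leg12 (E : A ⊗[k] A →ₗ[k] A ⊗[k] A) (ω : A →ₗ[k] k) (y : A) (z : A ⊗[k] A) :
    evalSnd A B.ε (E (y ⊗ₜ evalSnd A ω z)) = evalSnd A ω ((evalSnd A B.ε).rTensor A
      (leg12 A E ((TensorProduct.assoc k A A A).symm (y ⊗ₜ z)))) := by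
  induction z with
  | zero => simp
  | add x y hx hy => simp only [map_add, TensorProduct.tmul_add, hx, hy]
  | tmul s t => simp [leg12_tmul]

/-- The multiplier E on the first two legs commutes with T₁ on the last two, so the counit on the
middle leg removes T₁ and leaves a slice of E. -/
lemma piBarR_evalSnd (ω : A →ₗ[k] k) (a b y : A) :
    (piBarR B (evalSnd A ω (B.T₁ (a ⊗ₜ b)))).1 y = evalSnd A ω (B.E₁ (y ⊗ₜ (a * b))) := by
  have h := LinearMap.congr_fun B.E_comul (y ⊗ₜ a ⊗ₜ b)
  simp only [comp_apply, leg23_tmul, leg12_tmul] at h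
  rw [piBarR_fst, evalSnd_leg12, h, evalSnd_leg23_T₁, ← E₁_right]

lemma piR_evalSnd (ω : A →ₗ[k] k) (a b z : A) :
    (piR B (evalSnd A ω (B.T₃ (a ⊗ₜ b)))).2 z = evalSnd A ω (B.E₂ (z ⊗ₜ (b * a))) := by
  have h := LinearMap.congr_fun B.E_comul_op (z ⊗ₜ a ⊗ₜ b)
  simp only [comp_apply, leg23_tmul, leg12_tmul] at h
  rw [piR_snd, evalSnd_leg12, h, evalSnd_leg23_T₃, ← E₂_left]

/-- Both multipliers are the same slice (A ⊗ ω)((1 ⊗ cd)E(1 ⊗ ab)) of E, computed from the right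
factor on one side and from the left factor on the other. -/
lemma piBarR_eq_piR (ω : A →ₗ[k] k) (a b c d : A) :
    piBarR B (evalSnd A (ω ∘ₗ mulLeft k (c * d)) (B.T₁ (a ⊗ₜ b))) =
      piR B (evalSnd A (ω ∘ₗ mulRight k (a * b)) (B.T₃ (d ⊗ₜ c))) := by
  have key : ∀ y z : A,
      z * (piBarR B (evalSnd A (ω ∘ₗ mulLeft k (c * d)) (B.T₁ (a ⊗ₜ b)))).1 y =
      (piR B (evalSnd A (ω ∘ₗ mulRight k (a * b)) (B.T₃ (d ⊗ₜ c)))).2 z * y := by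
    intro y z
    rw [piBarR_evalSnd, piR_evalSnd, evalSnd_comp, evalSnd_comp]
    have h := B.E_multiplier z (c * d) y (a * b)
    rw [IdemSystem.map_eq, IdemSystem.map_eq] at h
    have := congrArg (evalSnd A ω) h
    rwa [evalSnd_rTensor, evalSnd_rTensor] at this
  refine Prod.ext (LinearMap.ext fun y => B.ext_mulLeft fun z => ?_)
    (LinearMap.ext fun z => B.ext_mulRight fun y => ?_)
  · rw [key, mul_piR]
  · rw [← mul_piBarR, key]

/-- If the comultiplication is right full, the range of `⊓̄ᴿ` is contained in that of `⊓ᴿ`. -/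
lemma piBarR_mem_base (hB : B.RightFull) (x : A) : piBarR B x ∈ base B := by
  let S : Submodule k A := (base B).comap (piBarR B)
  have h1 : ∀ (ω : A →ₗ[k] k) (a b c : A),
      evalSnd A ω ((mulLeft k c).lTensor A (B.T₁ (a ⊗ₜ b))) ∈ S := by
    intro ω a b c
    have hc : c ∈ Submodule.span k {x : A | ∃ a b : A, x = a * b} := by
      rw [B.idempotent]; trivial
    rw [← evalSnd_comp]
    induction hc using Submodule.span_induction with
    | zero => simp [evalSnd]
    | add c d _ _ hc hd =>
      rw [evalSnd_comp] at hc hd ⊢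
      have : mulLeft k (c + d) = mulLeft k c + mulLeft k d := by ext; simp [add_mul]
      rw [this, lTensor_add, LinearMap.add_apply, map_add]
      exact add_mem hc hd
    | smul s c _ hc =>
      rw [evalSnd_comp] at hc ⊢
      have : mulLeft k (s • c) = s • mulLeft k c := by ext; simp [smul_mul_assoc]
      rw [this, lTensor_smul, LinearMap.smul_apply, map_smul]
      exact S.smul_mem s hc
    | mem x hx =>
      obtain ⟨c, d, rfl⟩ := hx
      exact ⟨_, (B.piBarR_eq_piR ω a b c d).symm⟩
  -- An arbitrary functional need not factor through left multiplications, so c is cancelled instead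
  -- inside (A/S) ⊗ A, by non-degeneracy.
  have h2 : ∀ a b : A, S.mkQ.rTensor A (B.T₁ (a ⊗ₜ b)) = 0 := by
    refine fun a b =>
      eq_zero_of_lTensor (fun c => mulLeft k c) B.nondeg_right _ fun c =>
      eq_zero_of_evalSnd _ fun ω => ?_
    rw [← rTensor_lTensor_comm, evalSnd_rTensor]
    exact (Submodule.Quotient.mk_eq_zero S).2 (h1 ω a b c)
  suffices h : (⊤ : Submodule k A) ≤ S from h trivial
  rw [← hB, Submodule.span_le]
  rintro _ ⟨a, b, ω, rfl⟩
  refine (Submodule.Quotient.mk_eq_zero S).1 ?_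
  rw [← Submodule.mkQ_apply, ← evalSnd_rTensor, h2, map_zero]

/-- Elements `β(a)` with `⊓ᴿ(β(a)) = ⊓̄ᴿ(a)` can be chosen linearly. -/
lemma exists_piR_eq_piBarR (hB : B.RightFull) : ∃ β : A →ₗ[k] A, ∀ a, piR B (β a) = piBarR B a := by
  obtain ⟨g, hg⟩ := (piR B).rangeRestrict.exists_rightInverse_of_surjective
    (range_rangeRestrict _)
  refine ⟨g ∘ₗ (piBarR B).codRestrict (base B) (B.piBarR_mem_base hB), fun a => ?_⟩
  exact congrArg Subtype.val (LinearMap.congr_fun hg ⟨piBarR B a, B.piBarR_mem_base hB a⟩)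

end RegularWeakMultiplierBialgebra

namespace RightComodule

variable {V W : Type*} [AddCommGroup V] [Module k V] [AddCommGroup W] [Module k W]
  {C : RightComodule B V} {D : RightComodule B W}

/-- A full comodule `V` satisfies `V R = V`. -/
lemma Full.span_action (hC : C.Full) :
    Submodule.span k {x : V | ∃ (v : V) (a : A), x = evalSnd V B.ε (C.lam (v ⊗ₜ a))} = ⊤ := by
  set S := Submodule.span k {x : V | ∃ (v : V) (a : A), x = evalSnd V B.ε (C.lam (v ⊗ₜ a))}
  -- For c = ab, λ(v ⊗ ab) = (V ⊗ ε ⊗ A)(V ⊗ T₁)(λ(v ⊗ a) ⊗ b), and coassociativity makes ε follow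
  -- an application of λ, so the first leg lies in S.
  have h1 : ∀ v c, S.mkQ.rTensor A (C.lam (v ⊗ₜ c)) = 0 := by
    intro v c
    have hc : c ∈ Submodule.span k {x : A | ∃ a b : A, x = a * b} := by
      rw [B.idempotent]; trivial
    induction hc using Submodule.span_induction with
    | zero => simp
    | add x y _ _ hx hy => rw [TensorProduct.tmul_add, map_add, map_add, hx, hy, add_zero]
    | smul s x _ hx => rw [TensorProduct.tmul_smul, map_smul, map_smul, hx, smul_zero]
    | mem x hx =>
      obtain ⟨a, b, rfl⟩ := hx
      have h := LinearMap.congr_fun C.coassoc (v ⊗ₜ a ⊗ₜ b)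
      simp only [comp_apply, leg23_tmul, leg12_tmul] at h
      rw [lam_mul, ← B.evalSnd_leg23_T₁, ← h]
      generalize B.T₁ (a ⊗ₜ b) = z
      induction z with
      | zero => simp
      | add x y hx hy => simp only [map_add, TensorProduct.tmul_add, hx, hy, add_zero]
      | tmul s t =>
        rw [TensorProduct.assoc_symm_tmul, leg13_tmul]
        generalize C.lam (v ⊗ₜ t) = w
        induction w with
        | zero => simp
        | add x y hx hy => simp only [map_add, TensorProduct.add_tmul, hx, hy, add_zero]
        | tmul u r =>
          rw [TensorProduct.rightComm_tmul, leg12_tmul, rTensor_tmul, rTensor_tmul,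
            Submodule.mkQ_apply, (Submodule.Quotient.mk_eq_zero S).2
              (Submodule.subset_span ⟨u, s, rfl⟩), TensorProduct.zero_tmul]
  rw [eq_top_iff, ← hC, Submodule.span_le]
  rintro _ ⟨v, a, ω, rfl⟩
  refine (Submodule.Quotient.mk_eq_zero S).1 ?_
  rw [← Submodule.mkQ_apply, ← evalSnd_rTensor, h1, map_zero]

lemma baseProj_action (hB : B.RightFull) (v : V) (w : W) {a b : A} (h : piR B b = piBarR B a) :
    baseProj C D (evalSnd V B.ε (C.lam (v ⊗ₜ a)) ⊗ₜ w) =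
      baseProj C D (v ⊗ₜ evalSnd W B.ε (D.rho (w ⊗ₜ b))) :=
  (Submodule.Quotient.eq _).2 (Submodule.subset_span ⟨piBarR B a, B.piBarR_mem_base hB a, v, _, w,
    _, ⟨a, rfl, rfl⟩, ⟨b, h.symm, rfl⟩, rfl⟩)

/-- Compatibility gives ϱ(w ⊗ b)(1 ⊗ c) = (1 ⊗ b)λ(w ⊗ c). Consequently R, whose left action is
defined through ϱ, kills every w with zero coaction. -/
lemma rho_eq_zero {w : W} (h : ∀ c, D.lam (w ⊗ₜ c) = 0) (b : A) : D.rho (w ⊗ₜ b) = 0 :=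
  B.ext_mulRight_lTensor fun c => by rw [← D.comp, h, map_zero, map_zero]

/-- If `λ(w ⊗ -) = 0`, then `v ⊗ w` vanishes in `V ⊗_R W`. -/
lemma baseProj_eq_zero (hB : B.RightFull) (hC : C.Full) {w : W} (h : ∀ c, D.lam (w ⊗ₜ c) = 0)
    (v : V) : baseProj C D (v ⊗ₜ w) = 0 := by
  have hv : v ∈ Submodule.span k
      {x : V | ∃ (v : V) (a : A), x = evalSnd V B.ε (C.lam (v ⊗ₜ a))} := by
    rw [hC.span_action]; trivial
  obtain ⟨β, hβ⟩ := B.exists_piR_eq_piBarR hB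
  induction hv using Submodule.span_induction with
  | zero => simp
  | add x y _ _ hx hy => rw [TensorProduct.add_tmul, map_add, hx, hy, add_zero]
  | smul s x _ hx => rw [← TensorProduct.smul_tmul', map_smul, hx, smul_zero]
  | mem x hx =>
    obtain ⟨v, a, rfl⟩ := hx
    rw [baseProj_action hB v w (hβ a), rho_eq_zero h, map_zero, TensorProduct.tmul_zero, map_zero]

/-- The coaction does not distinguish `∑ ⊓̄ᴿ(aᵢ) wᵢ` and `w ⊓̄ᴿ(a)`, for
`λ(w ⊗ a) = ∑ wᵢ ⊗ aᵢ`. -/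
lemma lam_action_lam {β : A →ₗ[k] A} (hβ : ∀ a, piR B (β a) = piBarR B a) (w : W) (a c : A) :
    D.lam (evalSnd W B.ε (D.rho (β.lTensor W (D.lam (w ⊗ₜ a)))) ⊗ₜ c) =
      D.lam (evalSnd W B.ε (D.lam (w ⊗ₜ a)) ⊗ₜ c) := by
  -- The terms (1 ⊗ ⊓̄ᴿ(aᵢ))λ(wᵢ ⊗ c) sum to a slice by ε of E applied to the iterated coaction of
  -- w; that E is absorbed afterwards.
  have h : ∀ t : W ⊗[k] A, D.lam (evalSnd W B.ε (D.rho (β.lTensor W t)) ⊗ₜ c) =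
      (evalSnd A B.ε ∘ₗ B.E₁).lTensor W (TensorProduct.assoc k W A A
        (leg12 A D.lam (TensorProduct.rightComm k W A A (t ⊗ₜ c)))) := by
    intro t
    induction t with
    | zero => simp
    | add x y hx hy => simp only [map_add, TensorProduct.add_tmul, hx, hy]
    | tmul w a =>
      rw [lTensor_tmul, lam_left_action, hβ, TensorProduct.rightComm_tmul, leg12_tmul,
        lTensor_assoc_tmul]
      rfl
  rw [h, ← twice_tmul, lTensor_comp_apply, evalSnd_twice]
  exact congrArg _ (D.toDelta.lTensor_E₁_twice w (c ⊗ₜ a))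

/-- Every comodule structure on `V ⊗_R W` for which the projection is a morphism is full. -/
lemma full_of_isComoduleHom_baseProj (hB : B.RightFull) (hC : C.Full) (hD : D.Full)
    {P : RightComodule B (BaseTensor C D)} (hP : IsComoduleHom (C.tensor D) P (baseProj C D)) :
    P.Full := by
  obtain ⟨β, hβ⟩ := B.exists_piR_eq_piBarR hB
  set S := Submodule.span k {x : BaseTensor C D | ∃ (v : BaseTensor C D) (a : A) (ω : A →ₗ[k] k),
    x = evalSnd _ ω (P.lam (v ⊗ₜ a))} with hS
  have h1 : ∀ (v : V) (t : W ⊗[k] A), baseProj C D (evalSnd (V ⊗[k] W) B.ε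
      (leg13 W C.lam ((TensorProduct.assoc k V W A).symm (v ⊗ₜ t)))) =
      baseProj C D (v ⊗ₜ evalSnd W B.ε (D.rho (β.lTensor W t))) := by
    intro v t
    induction t with
    | zero => simp
    | add x y hx hy => simp only [map_add, TensorProduct.tmul_add, hx, hy]
    | tmul w a =>
      rw [lTensor_tmul, ← baseProj_action hB v w (hβ a), TensorProduct.assoc_symm_tmul, leg13_tmul]
      generalize C.lam (v ⊗ₜ a) = z
      congr 1
      induction z with
      | zero => simp
      | add x y hx hy => simp only [map_add, TensorProduct.add_tmul, hx, hy]
      | tmul u b => simp [TensorProduct.smul_tmul']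
  have h2 : ∀ (v : V) (w : W) (a : A),
      baseProj C D (v ⊗ₜ evalSnd W B.ε (D.lam (w ⊗ₜ a))) ∈ S := by
    intro v w a
    -- The two vectors of W need not be equal, but their difference has zero coaction and so
    -- disappears in V ⊗_R W.
    have e : baseProj C D (v ⊗ₜ (evalSnd W B.ε (D.rho (β.lTensor W (D.lam (w ⊗ₜ a)))) -
        evalSnd W B.ε (D.lam (w ⊗ₜ a)))) = 0 :=
      baseProj_eq_zero hB hC (fun c => by
        rw [TensorProduct.sub_tmul, map_sub, lam_action_lam hβ, sub_self]) v
    rw [TensorProduct.tmul_sub, map_sub, sub_eq_zero] at e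
    rw [← e, ← h1, ← tensor_lam_tmul, ← evalSnd_rTensor]
    have := LinearMap.congr_fun hP.1 (v ⊗ₜ w ⊗ₜ a)
    simp only [comp_apply, rTensor_tmul] at this
    rw [← this]
    exact Submodule.subset_span ⟨_, _, _, rfl⟩
  have h3 : ∀ (v : V) (w : W), baseProj C D (v ⊗ₜ w) ∈ S := by
    intro v w
    have hw : w ∈ Submodule.span k
        {x : W | ∃ (v : W) (a : A), x = evalSnd W B.ε (D.lam (v ⊗ₜ a))} := by
      rw [hD.span_action]; trivial
    induction hw using Submodule.span_induction with
    | zero => simp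
    | add x y _ _ hx hy => rw [TensorProduct.tmul_add, map_add]; exact add_mem hx hy
    | smul s x _ hx => rw [TensorProduct.tmul_smul, map_smul]; exact S.smul_mem s hx
    | mem x hx => obtain ⟨w, a, rfl⟩ := hx; exact h2 v w a
  refine eq_top_iff.2 fun x _ => ?_
  obtain ⟨x, rfl⟩ := baseProj_surjective C D x
  change baseProj C D x ∈ S
  induction x with
  | zero => simp
  | add x y hx hy => rw [map_add]; exact add_mem (hx trivial) (hy trivial)
  | tmul v w => exact h3 v w

end RightComodule

end WeakMultiplier
theorem mainTheorem7 {k A V W : Type*} [Field k] [NonUnitalRing A] [Module k A]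
    [IsScalarTower k A A] [SMulCommClass k A A] [AddCommGroup V] [Module k V] [AddCommGroup W]
    [Module k W] (B : WeakMultiplier.RegularWeakMultiplierBialgebra k A) (hB : B.RightFull)
    (C : WeakMultiplier.RightComodule B V) (D : WeakMultiplier.RightComodule B W)
    (hC : C.Full) (hD : D.Full) :
    (∃! P : WeakMultiplier.RightComodule B (WeakMultiplier.BaseTensor C D),
      WeakMultiplier.IsComoduleHom (C.tensor D) P (WeakMultiplier.baseProj C D)) ∧
    ∀ P : WeakMultiplier.RightComodule B (WeakMultiplier.BaseTensor C D),
      WeakMultiplier.IsComoduleHom (C.tensor D) P (WeakMultiplier.baseProj C D) → P.Full := by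
  obtain ⟨P, hP⟩ := C.exists_isComoduleHom_baseProj D
  exact ⟨⟨P, hP, fun Q hQ => WeakMultiplier.RightComodule.eq_of_isComoduleHom_surjective
    (C.tensor D) (C.baseProj_surjective D) hQ hP⟩,
    fun _ => WeakMultiplier.RightComodule.full_of_isComoduleHom_baseProj hB hC hD⟩
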